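/- Let $\mathfrak{o}$ be a compact discrete valuation ring (with its $\mathfrak m$-adic topology, $\mathfrak m$ the maximal ideal), $\pi$ a uniformizer and $q=\#(\mathfrak{o}/\mathfrak{m})$. Give $\mathfrak{o}^n$ componentwise multiplication. For $I\subseteq\{1,\dots,n-1\}$ non-empty, $r_0\in\mathbb{Z}_{\ge 0}$ and $\mathbf r=(r_\iota)_{\iota\in I}\in\mathbb{Z}_{\ge 1}^I$, let $D(I,\mathbf r)$ be the diagonal $n\times n$ matrix whose $k$-th diagonal entry is $\pi^{\sum_{\iota\in I,\ \iota\ge k} r_\iota}$, and let $h_n(I,r_0,\mathbf r)$ be the number of finite-index $\mathfrak{o}$-submodules $\Lambda\le\mathfrak{o}^n$ which are closed under multiplication and are generated by the rows of $\pi^{r_0}D(I,\mathbf r)A$ for some $A\in\mathrm{GL}_n(\mathfrak{o})$. Put $$\Xi_{n,I}\bigl(s_0,(s_\iota)_{\iota\in I}\bigr)=\sum_{(r_0,\mathbf r)\in\mathbb{Z}_{\ge 0}\times\mathbb{Z}_{\ge 1}^I} q^{-s_0 n r_0-\sum_{\iota\in I} r_\iota\,\iota\, s_\iota}\,h_n(I,r_0,\mathbf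 r).$$ Let $s_0,s_1,s_2\in\mathbb{C}$ with $\Re s_0>0$, $\Re s_1>0$, $\Re s_2>0$, $\Re(3s_0+s_1)>2$, $\Re(3s_0+2s_2)>2$, $\Re(s_1+2s_2)>1$ and $\Re(3s_0+s_1+2s_2)>3$, and set $X=q^{-3s_0}$, $Y=q^{-s_1+2}$, $Z=q^{-2s_2+2}$ (so that $X$, $XY$, $XZ$, $q^{-2}Y$, $q^{-2}Z$, $q^{-3}YZ$, $q^{-1}XYZ$ all have absolute value less than $1$). Then the series $\Xi_{3,\{1,2\}}(s_0,s_1,s_2)$ converges absolutely and $$\Xi_{3,\{1,2\}}(s_0,s_1,s_2)=\frac{YZ\;P(X,Y,Z;q)}{q^{11}(1-X)(1-XY)(1-XZ)(1-q^{-2}Y)(1-q^{-2}Z)(1-q^{-3}YZ)(1-q^{-1}XYZ)},$$ where $P(X,Y,Z;q)=a_0+a_1X+a_2X^2+a_3X^3$ with $$\begin{aligned} a_0&=(4q^8+10q^7)+(8q^6-4q^5)Y-18q^4YZ,\\ a_1&=(q^{10}+8q^9-3q^8-10q^7)+(2q^8-11q^7-q^6)Z+(5q^8-20q^7-9q^6+4q^5)Y\\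 &\quad+(-q^7-32q^6+6q^5+19q^4)YZ+(-6q^5+19q^4+q^3)YZ^2\\ &\quad+(-5q^5+12q^4+5q^3)Y^2Z+(12q^3+5q^2-q)Y^2Z^2,\\ a_2&=(q^{11}+q^{10}-6q^9)+(-q^9-7q^8+18q^7)Y+(-q^9-4q^8+9q^7)Z\\ &\quad+(-14q^8+5q^7+32q^6-5q^5)YZ+(11q^6+6q^5-17q^4)YZ^2\\ &\quad+(8q^6+14q^5-10q^4-4q^3)Y^2Z+(13q^5+2q^4-18q^3-7q^2)Y^2Z^2\\ &\quad+(-7q^3-7q^2)Y^3Z^2+(-6q^3-6q^2)Y^2Z^3,\\ a_3&=(-q^{10}-2q^9+11q^8-6q^7)YZ+(q^8+2q^7-8q^6+3q^5)YZ^2+(q^8+2q^7-5q^6-6q^5)Y^2Z\\ &\quad+(q^7+q^6-13q^5-4q^4+3q^3)Y^2Z^2+(-q^5-2q^4+4q^3+5q^2)Y^2Z^3\\ &\quad+(-q^5-2q^4+5q^3+6q^2)Y^3Z^2+(q^3+2q^2+2q+1)Y^3Z^3. \end{aligned}$$ -/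

import Mathlib

/-- `Λ ≤_s 𝔬ⁿ`: the submodule `Λ` of `𝔬ⁿ` has finite index and is closed under the
componentwise multiplication of `𝔬ⁿ`. -/
structure IsFiniteIndexSubalgebra {O : Type*} [CommRing O] {n : ℕ}
    (L : Submodule O (Fin n → O)) : Prop where
  finite_quotient : Finite ((Fin n → O) ⧸ L)
  mul_mem : ∀ x ∈ L, ∀ y ∈ L, x * y ∈ L

/-- The diagonal matrix `D(I, r)`: its `k`-th diagonal entry (`1 ≤ k ≤ n`) is `π` to the power
`∑_{ι ∈ I, k ≤ ι} r_ι`. The index `i : Fin n` corresponds to `k = i + 1`. -/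
def elementaryDivisorMatrix {O : Type*} [CommRing O] (π : O) (n : ℕ) (I : Finset ℕ)
    (r : I → ℕ+) : Matrix (Fin n) (Fin n) O :=
  Matrix.diagonal fun i => π ^ (∑ ι : I, if (i : ℕ) + 1 ≤ (ι : ℕ) then (r ι : ℕ) else 0)

/-- `ν₀(Λ) = (I, r₀, r)`: the submodule `Λ` is generated by the rows of `π^{r₀} D(I, r) A` for
some `A ∈ GL_n(𝔬)`. -/
def HasElementaryDivisorType {O : Type*} [CommRing O] (π : O) {n : ℕ}
    (L : Submodule O (Fin n → O)) (I : Finset ℕ) (r₀ : ℕ) (r : I → ℕ+) : Prop :=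
  ∃ A : GL (Fin n) O,
    L = Submodule.span O (Set.range
      (π ^ r₀ • (elementaryDivisorMatrix π n I r * (A : Matrix (Fin n) (Fin n) O))).row)

/-- `h_n(I, r₀, r)`: the number of `Λ ≤_s 𝔬ⁿ` with `ν₀(Λ) = (I, r₀, r)`. -/
noncomputable def subalgebraCount {O : Type*} [CommRing O] (π : O) (n : ℕ) (I : Finset ℕ)
    (r₀ : ℕ) (r : I → ℕ+) : ℕ :=
  Set.ncard {L : Submodule O (Fin n → O) |
    IsFiniteIndexSubalgebra L ∧ HasElementaryDivisorType π L I r₀ r}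

/-- The cardinality `q` of the residue field. -/
noncomputable def residueCard (O : Type*) [CommRing O] [IsLocalRing O] : ℕ :=
  Nat.card (IsLocalRing.ResidueField O)

/-- The term `q^{- s₀ n r₀ - ∑_{ι ∈ I} r_ι ι s_ι} h_n(I, r₀, r)` of the series `Ξ_{n,I}`, indexed
by `(r₀, r) ∈ ℕ₀ × ℕ^I`. Only the values `s ι` with `ι ∈ I` are used. -/
noncomputable def xiTerm {O : Type*} [CommRing O] [IsLocalRing O] (π : O) (n : ℕ)
    (I : Finset ℕ) (s₀ : ℂ) (s : ℕ → ℂ) (k : ℕ × (I → ℕ+)) : ℂ :=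
  (residueCard O : ℂ) ^
      (-(s₀ * (n : ℂ) * (k.1 : ℂ)) - ∑ ι : I, ((k.2 ι : ℕ) : ℂ) * ((ι : ℕ) : ℂ) * s ι)
    * (subalgebraCount π n I k.1 k.2 : ℂ)

/-- The series `Ξ_{n,I}(s₀, (s_ι)_{ι ∈ I})`. -/
noncomputable def xi {O : Type*} [CommRing O] [IsLocalRing O] (π : O) (n : ℕ)
    (I : Finset ℕ) (s₀ : ℂ) (s : ℕ → ℂ) : ℂ :=
  ∑' k : ℕ × (I → ℕ+), xiTerm π n I s₀ s k

/-- The coefficient `a₀` of `P`. -/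
def coeffA0 (Y Z q : ℂ) : ℂ :=
  (4*q^8 + 10*q^7) + (8*q^6 - 4*q^5)*Y - 18*q^4*Y*Z

/-- The coefficient `a₁` of `P`. -/
def coeffA1 (Y Z q : ℂ) : ℂ :=
  (q^10 + 8*q^9 - 3*q^8 - 10*q^7)
    + (2*q^8 - 11*q^7 - q^6)*Z + (5*q^8 - 20*q^7 - 9*q^6 + 4*q^5)*Y
    + (-q^7 - 32*q^6 + 6*q^5 + 19*q^4)*Y*Z
    + (-6*q^5 + 19*q^4 + q^3)*Y*Z^2
    + (-5*q^5 + 12*q^4 + 5*q^3)*Y^2*Z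
    + (12*q^3 + 5*q^2 - q)*Y^2*Z^2

/-- The coefficient `a₂` of `P`. -/
def coeffA2 (Y Z q : ℂ) : ℂ :=
  (q^11 + q^10 - 6*q^9)
    + (-q^9 - 7*q^8 + 18*q^7)*Y
    + (-q^9 - 4*q^8 + 9*q^7)*Z
    + (-14*q^8 + 5*q^7 + 32*q^6 - 5*q^5)*Y*Z
    + (11*q^6 + 6*q^5 - 17*q^4)*Y*Z^2
    + (8*q^6 + 14*q^5 - 10*q^4 - 4*q^3)*Y^2*Z
    + (13*q^5 + 2*q^4 - 18*q^3 - 7*q^2)*Y^2*Z^2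
    + (-7*q^3 - 7*q^2)*Y^3*Z^2
    + (-6*q^3 - 6*q^2)*Y^2*Z^3

/-- The coefficient `a₃` of `P`. -/
def coeffA3 (Y Z q : ℂ) : ℂ :=
  (-q^10 - 2*q^9 + 11*q^8 - 6*q^7)*Y*Z
    + (q^8 + 2*q^7 - 8*q^6 + 3*q^5)*Y*Z^2
    + (q^8 + 2*q^7 - 5*q^6 - 6*q^5)*Y^2*Z
    + (q^7 + q^6 - 13*q^5 - 4*q^4 + 3*q^3)*Y^2*Z^2
    + (-q^5 - 2*q^4 + 4*q^3 + 5*q^2)*Y^2*Z^3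
    + (-q^5 - 2*q^4 + 5*q^3 + 6*q^2)*Y^3*Z^2
    + (q^3 + 2*q^2 + 2*q + 1)*Y^3*Z^3

/-- The polynomial `P(X, Y, Z; q) = a₀ + a₁ X + a₂ X² + a₃ X³`. -/
def numeratorP (X Y Z q : ℂ) : ℂ :=
  coeffA0 Y Z q + coeffA1 Y Z q * X + coeffA2 Y Z q * X^2 + coeffA3 Y Z q * X^3

/-! Write v = q⁻¹ and (c, a, b) = (r₀, r₁, r₂). Up to a permutation σ of the coordinates, a lattice
of type (c, a, b) is π^c L, where L is spanned by (1, y, z), π^b (0, -g, 1) and π^(a+b) (0, 1, 0).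
The normalisation of the Bruhat decomposition makes σ unique, and the parameters unique once
representatives of y, z, g modulo π^(a+b), π^b, π^a are fixed (`exists_flagLattice_eq`,
`flagLattice_inj_perm`, `flagLattice_inj_params`). Closure under multiplication has to be tested on
generators only and becomes the four divisibilities of `IsMulClosedParam`, whose solutions are to be
counted.

If a + b ≤ c these are void, and the six cells add up to the normalised number of flags over the
residue field. Otherwise the first one reads y(y-1) + g z(z-1) ≡ 0 modulo π^(a+b-c). Sort y and z by
residue: 0, 1 or neither ("generic"). For y near 0 or 1, Hensel's lemma solves this equation for y;
if y and z are both generic it is linear in g with unit coefficient. One parameter thus disappears,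
and the other conditions become conditions on the remaining pair, counted by valuation
(`card_near_pairs`). The outcome is `cast_subalgebraCount`: the count is q^(2(a+b)) times
`latticeDensity`, and the power of q is absorbed into Y and Z.

Apart from one corner term, `latticeDensity` is a power of v times a polynomial of degree at most
one on each of eight simplicial cones that tile c ≥ 0, a, b ≥ 1. Each cone contributes a product of
three geometric series, one of them possibly with a linear weight (`hasSum_cone_geometric`). The ray
(1, 2, 1) on the wall a = b + c brings in the denominator (1 - v³XY²Z)², which cancels in the total
(`cones_eq`). -/

/-! ### Residue systems and Hensel counting -/

theorem pow_dvd_pow_mul_iff_pow_sub_dvd {O : Type*} [CommRing O] [IsDomain O] {π : O}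
    (hπ : π ≠ 0) (a c : ℕ) (w : O) : π ^ a ∣ π ^ c * w ↔ π ^ (a - c) ∣ w := by
  rcases le_total a c with h | h
  · simp only [Nat.sub_eq_zero_of_le h, pow_zero, one_dvd, iff_true]
    exact dvd_mul_of_dvd_left (pow_dvd_pow _ h) _
  · obtain ⟨d, rfl⟩ := Nat.exists_eq_add_of_le h
    rw [pow_add, mul_dvd_mul_iff_left (pow_ne_zero _ hπ), Nat.add_sub_cancel_left]

/-- `T n` is a system of representatives of the residue classes modulo `π ^ n`, with `q ^ n`
elements. -/
structure IsResidueSystem {O : Type*} [CommRing O] (π : O) (q : ℕ) (T : ℕ → Finset O) :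
    Prop where
  exists_rep : ∀ n x, ∃ t ∈ T n, π ^ n ∣ x - t
  eq_of_dvd : ∀ n, ∀ s ∈ T n, ∀ t ∈ T n, π ^ n ∣ s - t → s = t
  card_eq : ∀ n, (T n).card = q ^ n

/-- Sums of digits `∑ dᵢ πⁱ`, `i < n`, with digits in `R`. -/
noncomputable def digitSums {O : Type*} [CommRing O] (π : O) (R : Finset O) : ℕ → Finset O
  | 0 => {0}
  | n + 1 => open Classical in
    (digitSums π R n ×ˢ R).image fun p => p.1 + π ^ n * p.2

theorem isResidueSystem_digitSums {O : Type*} [CommRing O] [IsDomain O] {π : O} (hπ : π ≠ 0)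
    {R : Finset O} (h1 : ∀ x, ∃ t ∈ R, π ∣ x - t)
    (h2 : ∀ s ∈ R, ∀ t ∈ R, π ∣ s - t → s = t) :
    IsResidueSystem π R.card (digitSums π R) := by
  classical
  have key : ∀ n, ∀ s ∈ digitSums π R n, ∀ t ∈ digitSums π R n, ∀ d ∈ R, ∀ e ∈ R,
      (∀ s ∈ digitSums π R n, ∀ t ∈ digitSums π R n, π ^ n ∣ s - t → s = t) →
      π ^ (n + 1) ∣ (s + π ^ n * d) - (t + π ^ n * e) → s = t ∧ d = e := by
    intro n s hs t ht d hd e he ih h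
    have hst : s = t := by
      refine ih s hs t ht ?_
      have h' : π ^ n ∣ (s + π ^ n * d) - (t + π ^ n * e) :=
        (pow_dvd_pow _ (Nat.le_succ n)).trans h
      have : s - t = ((s + π ^ n * d) - (t + π ^ n * e)) - π ^ n * (d - e) := by ring
      rw [this]
      exact dvd_sub h' (dvd_mul_right _ _)
    refine ⟨hst, h2 d hd e he ?_⟩
    have : (s + π ^ n * d) - (t + π ^ n * e) = π ^ n * (d - e) := by rw [hst]; ring
    rw [this, pow_succ, mul_dvd_mul_iff_left (pow_ne_zero _ hπ)] at h
    exact h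
  have inj : ∀ n, ∀ s ∈ digitSums π R n, ∀ t ∈ digitSums π R n, π ^ n ∣ s - t → s = t := by
    intro n
    induction n with
    | zero => intro s hs t ht _; simp [digitSums] at hs ht; rw [hs, ht]
    | succ n ih =>
      intro s hs t ht h
      simp only [digitSums, Finset.mem_image, Finset.mem_product, Prod.exists] at hs ht
      obtain ⟨s, d, ⟨hs, hd⟩, rfl⟩ := hs
      obtain ⟨t, e, ⟨ht, he⟩, rfl⟩ := ht
      obtain ⟨rfl, rfl⟩ := key n s hs t ht d hd e he ih h
      rfl
  refine ⟨?_, inj, ?_⟩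
  · intro n
    induction n with
    | zero => intro x; exact ⟨0, by simp [digitSums]⟩
    | succ n ih =>
      intro x
      obtain ⟨t, ht, w, hw⟩ := ih x
      obtain ⟨d, hd, v, hv⟩ := h1 w
      refine ⟨t + π ^ n * d, ?_, v, ?_⟩
      · simp only [digitSums, Finset.mem_image, Finset.mem_product, Prod.exists]
        exact ⟨t, d, ⟨ht, hd⟩, rfl⟩
      · linear_combination hw + π ^ n * hv
  · intro n
    induction n with
    | zero => simp [digitSums]
    | succ n ih =>
      rw [digitSums, Finset.card_image_of_injOn, Finset.card_product, ih, pow_succ]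
      rintro ⟨s, d⟩ hs ⟨t, e⟩ ht h
      simp only [Finset.coe_product, Set.mem_prod, Finset.mem_coe] at hs ht
      obtain ⟨h1, h2⟩ := key n s hs.1 t ht.1 d hs.2 e ht.2 (inj n) (by simp_all)
      simp [h1, h2]

/-- The cosets of the maximal ideal are neighbourhoods of their points, so by compactness finitely
many of them cover the ring. -/
theorem finite_residueField_of_isAdic {O : Type*} [CommRing O] [IsLocalRing O]
    [TopologicalSpace O] [CompactSpace O] (hadic : IsAdic (IsLocalRing.maximalIdeal O)) :
    Finite (IsLocalRing.ResidueField O) := by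
  have hU : ∀ x : O, {y | y - x ∈ IsLocalRing.maximalIdeal O} ∈ nhds x := by
    intro x
    refine (hadic.hasBasis_nhds x).mem_iff.2 ⟨1, trivial, ?_⟩
    rintro _ ⟨y, hy, rfl⟩
    simpa using hy
  obtain ⟨t, -, ht⟩ := isCompact_univ.elim_nhds_subcover _ fun x _ => hU x
  refine Finite.of_surjective (fun x : t => IsLocalRing.residue O x) fun z => ?_
  obtain ⟨y, rfl⟩ := IsLocalRing.residue_surjective z
  obtain ⟨x, hx, hxy⟩ := Set.mem_iUnion₂.1 (ht (Set.mem_univ y))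
  refine ⟨⟨x, hx⟩, ?_⟩
  have : IsLocalRing.residue O (y - x) = 0 := (IsLocalRing.residue_eq_zero_iff _).2 hxy
  rw [map_sub, sub_eq_zero] at this
  exact this.symm

theorem dvd_iff_residue_eq_zero {O : Type*} [CommRing O] [IsDomain O] [IsDiscreteValuationRing O]
    {π : O} (hπ : Irreducible π) (x : O) : π ∣ x ↔ IsLocalRing.residue O x = 0 := by
  rw [IsLocalRing.residue_eq_zero_iff, hπ.maximalIdeal_eq, Ideal.mem_span_singleton]

theorem not_dvd_iff_isUnit {O : Type*} [CommRing O] [IsDomain O] [IsDiscreteValuationRing O]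
    {π : O} (hπ : Irreducible π) (x : O) : ¬ π ∣ x ↔ IsUnit x := by
  rw [← Ideal.mem_span_singleton, ← hπ.maximalIdeal_eq, IsLocalRing.mem_maximalIdeal,
    mem_nonunits_iff, not_not]

theorem exists_isResidueSystem {O : Type*} [CommRing O] [IsDomain O] [IsDiscreteValuationRing O]
    [Finite (IsLocalRing.ResidueField O)] {π : O} (hπ : Irreducible π) :
    ∃ T, IsResidueSystem π (residueCard O) T := by
  classical
  have := Fintype.ofFinite (IsLocalRing.ResidueField O)
  let σ : IsLocalRing.ResidueField O → O :=
    Function.surjInv IsLocalRing.residue_surjective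
  have hσ : ∀ x, IsLocalRing.residue O (σ x) = x := Function.surjInv_eq _
  have hinj : Function.Injective σ := Function.injective_surjInv _
  have hcard : (Finset.univ.image σ).card = residueCard O := by
    rw [Finset.card_image_of_injective _ hinj, Finset.card_univ, residueCard,
      Nat.card_eq_fintype_card]
  rw [← hcard]
  refine ⟨_, isResidueSystem_digitSums hπ.ne_zero ?_ ?_⟩
  · intro x
    refine ⟨σ (IsLocalRing.residue O x), by simp, ?_⟩
    rw [dvd_iff_residue_eq_zero hπ, map_sub, hσ, sub_self]
  · intro s hs t ht h
    obtain ⟨u, -, rfl⟩ := Finset.mem_image.1 hs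
    obtain ⟨v, -, rfl⟩ := Finset.mem_image.1 ht
    rw [dvd_iff_residue_eq_zero hπ, map_sub, hσ, hσ, sub_eq_zero] at h
    rw [h]

theorem one_lt_residueCard (O : Type*) [CommRing O] [IsLocalRing O]
    [Finite (IsLocalRing.ResidueField O)] : 1 < residueCard O :=
  Finite.one_lt_card

namespace IsResidueSystem

variable {O : Type*} [CommRing O] {π : O} {q : ℕ} {T : ℕ → Finset O}

/-- A class modulo π^j splits into q^(n-j) classes modulo π^n: s ↦ x + π^j s maps the
representatives modulo π^(n-j) bijectively onto them. -/
theorem card_filter_dvd_sub [IsDomain O]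
    (hT : IsResidueSystem π q T) (hπ : π ≠ 0) {j n : ℕ}
    (hj : j ≤ n) (x : O) (p : O → Prop) [DecidablePred p]
    (hp : ∀ t ∈ T n, p t ↔ π ^ j ∣ t - x) : ((T n).filter p).card = q ^ (n - j) := by
  rw [← hT.card_eq]
  choose rep hrep hdvd using hT.exists_rep n
  symm
  refine Finset.card_bij (fun s _ => rep (x + π ^ j * s)) ?_ ?_ ?_
  · intro s _
    refine Finset.mem_filter.2 ⟨hrep _, (hp _ (hrep _)).2 ?_⟩
    have := (pow_dvd_pow π hj).trans (hdvd (x + π ^ j * s))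
    have e : rep (x + π ^ j * s) - x = π ^ j * s - (x + π ^ j * s - rep (x + π ^ j * s)) := by
      ring
    rw [e]
    exact dvd_sub (dvd_mul_right _ _) this
  · intro s hs t ht h
    refine hT.eq_of_dvd _ s hs t ht ?_
    have h1 := dvd_sub (hdvd (x + π ^ j * s)) (hdvd (x + π ^ j * t))
    have h2 : x + π ^ j * s - rep (x + π ^ j * s) - (x + π ^ j * t - rep (x + π ^ j * t))
      = π ^ j * (s - t) := by rw [h]; ring
    rw [h2, pow_dvd_pow_mul_iff_pow_sub_dvd hπ] at h1
    exact h1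
  · intro t ht
    obtain ⟨ht, h⟩ := Finset.mem_filter.1 ht
    obtain ⟨w, hw⟩ := (hp t ht).1 h
    obtain ⟨s, hs, v, hv⟩ := hT.exists_rep (n - j) w
    refine ⟨s, hs, hT.eq_of_dvd n _ (hrep _) t ht ?_⟩
    have h1 := hdvd (x + π ^ j * s)
    have e : rep (x + π ^ j * s) - t
        = -(x + π ^ j * s - rep (x + π ^ j * s)) - π ^ (j + (n - j)) * v := by
      rw [pow_add]; linear_combination (-hw) - π ^ j * hv
    rw [e, Nat.add_sub_cancel' hj]
    exact dvd_sub (dvd_neg.2 h1) (dvd_mul_right _ _)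

end IsResidueSystem

/-- The polynomial `y (y - 1) + w` with `π ∣ w` has a root modulo `π ^ M` close to
an idempotent `e`. -/
theorem exists_dvd_mul_sub_one_add {O : Type*} [CommRing O] {π e w : O} (he : e * e = e)
    (hw : π ∣ w) (M : ℕ) : ∃ y, π ∣ y - e ∧ π ^ (M + 1) ∣ y * (y - 1) + w := by
  induction M with
  | zero =>
    refine ⟨e, by simp, ?_⟩
    have : e * (e - 1) + w = w := by linear_combination he
    simpa [this] using hw
  | succ M ih =>
    obtain ⟨y, ⟨u, hu⟩, hy⟩ := ih
    obtain ⟨v, hv⟩ := hy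
    -- A Newton step without division: (2e - 1)² = 1, so 2e - 1 is its own inverse, and it agrees
    -- with the derivative 2y - 1 modulo π.
    refine ⟨y - (2 * e - 1) * (y * (y - 1) + w), ?_, ?_⟩
    · refine ⟨u - (2 * e - 1) * π ^ M * v, ?_⟩
      rw [hv]; linear_combination hu
    · rw [hv]
      refine ⟨-2 * (2 * e - 1) * u * v + π ^ M * v ^ 2, ?_⟩
      have h4 : (2 * e - 1) * (2 * e - 1) = 1 := by linear_combination 4 * he
      have hye : y = e + π * u := by linear_combination hu
      rw [hye] at hv ⊢
      linear_combination hv + (π ^ (M + 1) * v) ^ 2 * h4 - π ^ (M + 1) * v * h4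

/-- Two values of y(y-1) + w differ by (y - x)(y + x - 1), and near e the second factor is congruent
to the unit 2e - 1. The roots modulo π^M near e therefore form a single class modulo π^M. -/
theorem IsResidueSystem.card_filter_root {O : Type*} [CommRing O] [IsDomain O]
    [IsDiscreteValuationRing O] {π : O} {q : ℕ} {T : ℕ → Finset O}
    (hT : IsResidueSystem π q T) (hπ : Irreducible π) {e w : O} (he : e * e = e) (hw : π ∣ w)
    {M n : ℕ} (hM : 1 ≤ M) (hMn : M ≤ n) (p : O → Prop) [DecidablePred p]
    (hp : ∀ y, p y ↔ π ∣ y - e ∧ π ^ M ∣ y * (y - 1) + w) :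
    ((T n).filter p).card = q ^ (n - M) := by
  obtain ⟨M, rfl⟩ := Nat.exists_eq_add_of_le' hM
  obtain ⟨x, hx1, hx2⟩ := exists_dvd_mul_sub_one_add he hw M
  classical
  refine hT.card_filter_dvd_sub hπ.ne_zero hMn x p fun y _ => ?_
  rw [hp]
  have hd : y * (y - 1) + w = (y - x) * (y + x - 1) + (x * (x - 1) + w) := by ring
  constructor
  · rintro ⟨h1, h2⟩
    have hu : IsUnit (y + x - 1) := by
      rw [← not_dvd_iff_isUnit hπ]
      intro h
      have h3 : π ∣ 2 * e - 1 := by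
        have : 2 * e - 1 = (y + x - 1) - (y - e) - (x - e) := by ring
        rw [this]; exact dvd_sub (dvd_sub h h1) hx1
      have h4 : (2 * e - 1) * (2 * e - 1) = 1 := by linear_combination 4 * he
      exact hπ.not_isUnit (isUnit_of_dvd_one (h4 ▸ dvd_mul_of_dvd_left h3 _))
    rw [hd] at h2
    exact (hu.dvd_mul_right).1 ((dvd_add_left hx2).1 h2)
  · intro h
    refine ⟨?_, ?_⟩
    · have := (dvd_pow_self π (Nat.succ_ne_zero M)).trans h
      have e : y - e = (y - x) + (x - e) := by ring
      rw [e]; exact dvd_add this hx1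
    · rw [hd]; exact dvd_add (dvd_mul_of_dvd_left h _) hx2

theorem IsResidueSystem.card_filter_not_dvd {O : Type*} [CommRing O] [IsDomain O] {π : O} {q : ℕ}
    {T : ℕ → Finset O} (hT : IsResidueSystem π q T) (hπ : Irreducible π) {n : ℕ} (hn : 1 ≤ n)
    {u v : O} (huv : IsUnit (u - v))
    (p : O → Prop) [DecidablePred p] (hp : ∀ y, p y ↔ ¬ π ∣ y - u ∧ ¬ π ∣ y - v) :
    ((T n).filter p).card + 2 * q ^ (n - 1) = q ^ n := by
  classical
  have h0 := hT.card_filter_dvd_sub hπ.ne_zero hn u (fun t => π ∣ t - u) fun _ _ => by simp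
  have h1 := hT.card_filter_dvd_sub hπ.ne_zero hn v (fun t => π ∣ t - v) fun _ _ => by simp
  have hd : Disjoint ((T n).filter fun t => π ∣ t - u) ((T n).filter fun t => π ∣ t - v) := by
    rw [Finset.disjoint_filter]
    intro t _ h h'
    refine hπ.not_isUnit (isUnit_of_dvd_unit ?_ huv)
    have : u - v = (t - v) - (t - u) := by ring
    rw [this]; exact dvd_sub h' h
  have h2 := Finset.card_union_of_disjoint hd
  rw [← Finset.filter_or, h0, h1] at h2
  have h3 := Finset.card_filter_add_card_filter_not (s := T n) (fun t => π ∣ t - u ∨ π ∣ t - v)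
  rw [hT.card_eq, h2] at h3
  have h4 : (T n).filter p = (T n).filter fun t => ¬ (π ∣ t - u ∨ π ∣ t - v) :=
    Finset.filter_congr fun t _ => by rw [hp, not_or]
  rw [h4]; omega

/-! ### Lattices in Bruhat coordinates and closure under multiplication -/

/-- The lattice `π ^ c L`, where `L` consists of the vectors `u` with
`π ^ b ∣ u₂ - z u₀` and `π ^ (a + b) ∣ (u₁ - y u₀) + g (u₂ - z u₀)`,
the coordinates being permuted by `σ`. -/
def flagLattice {O : Type*} [CommRing O] (π : O) (c a b : ℕ) (σ : Equiv.Perm (Fin 3))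
    (y z g : O) : Submodule O (Fin 3 → O) where
  carrier := {x | ∃ u : Fin 3 → O, x = π ^ c • u ∧ π ^ b ∣ u (σ 2) - z * u (σ 0) ∧
    π ^ (a + b) ∣ (u (σ 1) - y * u (σ 0)) + g * (u (σ 2) - z * u (σ 0))}
  zero_mem' := ⟨0, by simp⟩
  add_mem' := by
    rintro _ _ ⟨u, rfl, ⟨k, hk⟩, ⟨l, hl⟩⟩ ⟨w, rfl, ⟨k', hk'⟩, ⟨l', hl'⟩⟩
    refine ⟨u + w, by rw [smul_add], ⟨k + k', ?_⟩, ⟨l + l', ?_⟩⟩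
    · simp only [Pi.add_apply]; linear_combination hk + hk'
    · simp only [Pi.add_apply]; linear_combination hl + hl'
  smul_mem' := by
    rintro t _ ⟨u, rfl, ⟨k, hk⟩, ⟨l, hl⟩⟩
    refine ⟨t • u, by rw [smul_comm], ⟨t * k, ?_⟩, ⟨t * l, ?_⟩⟩
    · simp only [Pi.smul_apply, smul_eq_mul]; linear_combination t * hk
    · simp only [Pi.smul_apply, smul_eq_mul]; linear_combination t * hl

theorem mem_flagLattice {O : Type*} [CommRing O] {π : O} {c a b : ℕ} {σ : Equiv.Perm (Fin 3)}
    {y z g : O} {x : Fin 3 → O} : x ∈ flagLattice π c a b σ y z g ↔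
    ∃ u : Fin 3 → O, x = π ^ c • u ∧ π ^ b ∣ u (σ 2) - z * u (σ 0) ∧
    π ^ (a + b) ∣ (u (σ 1) - y * u (σ 0)) + g * (u (σ 2) - z * u (σ 0)) := Iff.rfl

theorem smul_mem_flagLattice {O : Type*} [CommRing O] [IsDomain O] {π : O} (hπ : π ≠ 0)
    {c a b : ℕ} {σ : Equiv.Perm (Fin 3)}
    {y z g : O} {u : Fin 3 → O} : π ^ c • u ∈ flagLattice π c a b σ y z g ↔
    π ^ b ∣ u (σ 2) - z * u (σ 0) ∧
    π ^ (a + b) ∣ (u (σ 1) - y * u (σ 0)) + g * (u (σ 2) - z * u (σ 0)) := by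
  rw [mem_flagLattice]
  constructor
  · rintro ⟨w, h, hw⟩
    have : u = w := by
      funext i
      have := congrFun h i
      simp only [Pi.smul_apply, smul_eq_mul] at this
      exact mul_left_cancel₀ (pow_ne_zero c hπ) this
    rwa [this]
  · exact fun h => ⟨u, rfl, h⟩

/-- The vector with coordinates `x₀, x₁, x₂` in the places `σ 0, σ 1, σ 2`. -/
def permVec {O : Type*} (σ : Equiv.Perm (Fin 3)) (x₀ x₁ x₂ : O) : Fin 3 → O :=
  fun i => ![x₀, x₁, x₂] (σ.symm i)

@[simp] theorem permVec_zero {O : Type*} (σ : Equiv.Perm (Fin 3)) (x₀ x₁ x₂ : O) :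
    permVec σ x₀ x₁ x₂ (σ 0) = x₀ := by simp [permVec]

@[simp] theorem permVec_one {O : Type*} (σ : Equiv.Perm (Fin 3)) (x₀ x₁ x₂ : O) :
    permVec σ x₀ x₁ x₂ (σ 1) = x₁ := by simp [permVec]

@[simp] theorem permVec_two {O : Type*} (σ : Equiv.Perm (Fin 3)) (x₀ x₁ x₂ : O) :
    permVec σ x₀ x₁ x₂ (σ 2) = x₂ := by simp [permVec]

theorem perm_funext_iff {O : Type*} (σ : Equiv.Perm (Fin 3)) (x w : Fin 3 → O) :
    x = w ↔ x (σ 0) = w (σ 0) ∧ x (σ 1) = w (σ 1) ∧ x (σ 2) = w (σ 2) := by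
  refine ⟨by rintro rfl; simp, fun h => ?_⟩
  have : ∀ j, x (σ j) = w (σ j) := by
    intro j; fin_cases j
    exacts [h.1, h.2.1, h.2.2]
  funext i
  simpa using this (σ.symm i)

/-- The conditions on the parameters of `flagLattice` for it to be closed under multiplication. -/
def IsMulClosedParam {O : Type*} [CommRing O] (π : O) (c a b : ℕ) (y z g : O) : Prop :=
  π ^ (a + b) ∣ π ^ c * (y * (y - 1) + g * (z * (z - 1))) ∧
  π ^ b ∣ π ^ c * (z * (z - 1)) ∧
  π ^ a ∣ π ^ c * (g * (z - y)) ∧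
  π ^ a ∣ π ^ (b + c) * (g * (1 + g))

/-- Let v = (1, y, z) and w = (0, -gπ^b, π^b), before scaling by π^c. The square of v gives the
first two conditions; v·w and w², after cancelling π^b, give the third and the fourth. Products with
the last generator (0, π^(a+b), 0) impose nothing. -/
theorem mul_mem_flagLattice_iff {O : Type*} [CommRing O] [IsDomain O] {π : O} (hπ : π ≠ 0)
    {c a b : ℕ} {σ : Equiv.Perm (Fin 3)} {y z g : O} :
    (∀ x ∈ flagLattice π c a b σ y z g, ∀ w ∈ flagLattice π c a b σ y z g,
      x * w ∈ flagLattice π c a b σ y z g) ↔ IsMulClosedParam π c a b y z g := by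
  have hmul : ∀ u w : Fin 3 → O, (π ^ c • u) * (π ^ c • w) = π ^ c • (π ^ c • (u * w)) := by
    intro u w; funext i; simp only [Pi.mul_apply, Pi.smul_apply, smul_eq_mul]; ring
  constructor
  · intro h
    have hv : π ^ c • permVec σ 1 y z ∈ flagLattice π c a b σ y z g := by
      rw [smul_mem_flagLattice hπ]; simp
    have hw : π ^ c • permVec σ 0 (-g * π ^ b) (π ^ b) ∈ flagLattice π c a b σ y z g := by
      rw [smul_mem_flagLattice hπ]; simp
    have hvv := h _ hv _ hv
    have hvw := h _ hv _ hw
    have hww := h _ hw _ hw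
    rw [hmul, smul_mem_flagLattice hπ] at hvv hvw hww
    simp only [Pi.mul_apply, Pi.smul_apply, smul_eq_mul, permVec_zero, permVec_one,
      permVec_two] at hvv hvw hww
    refine ⟨?_, ?_, ?_, ?_⟩
    · convert hvv.2 using 1; ring
    · convert hvv.1 using 1; ring
    · refine (mul_dvd_mul_iff_right (pow_ne_zero b hπ)).1 ?_
      rw [← pow_add]
      convert hvw.2 using 1; ring
    · refine (mul_dvd_mul_iff_right (pow_ne_zero b hπ)).1 ?_
      rw [← pow_add]
      convert hww.2 using 1; ring
  · rintro ⟨⟨k1, h1⟩, ⟨k2, h2⟩, ⟨k3, h3⟩, ⟨k4, h4⟩⟩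
    rintro _ ⟨u, rfl, ⟨p, hp⟩, ⟨t, ht⟩⟩ _ ⟨w, rfl, ⟨p', hp'⟩, ⟨t', ht'⟩⟩
    rw [hmul, smul_mem_flagLattice hπ]
    simp only [Pi.mul_apply, Pi.smul_apply, smul_eq_mul]
    generalize u (σ 0) = u0, u (σ 1) = u1, u (σ 2) = u2 at hp ht ⊢
    generalize w (σ 0) = w0, w (σ 1) = w1, w (σ 2) = w2 at hp' ht' ⊢
    obtain rfl : u2 = z * u0 + π ^ b * p := by linear_combination hp
    obtain rfl : w2 = z * w0 + π ^ b * p' := by linear_combination hp'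
    obtain rfl : u1 = y * u0 - g * π ^ b * p + π ^ (a + b) * t := by linear_combination ht
    obtain rfl : w1 = y * w0 - g * π ^ b * p' + π ^ (a + b) * t' := by linear_combination ht'
    constructor
    · refine ⟨k2 * u0 * w0 + π ^ c * (z * u0 * p' + z * w0 * p + π ^ b * p * p'), ?_⟩
      linear_combination u0 * w0 * h2
    · refine ⟨k1 * u0 * w0 + (u0 * p' + w0 * p) * k3 + p * p' * k4 +
        π ^ c * ((y * u0 - g * π ^ b * p) * t' + (y * w0 - g * π ^ b * p') * t
          + π ^ (a + b) * t * t'), ?_⟩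
      rw [pow_add] at h4
      rw [pow_add] at h1 ⊢
      linear_combination u0 * w0 * h1 + (u0 * p' + w0 * p) * π ^ b * h3 + p * p' * π ^ b * h4

/-- The lattice contains π^(c+a+b) 𝔬³. -/
theorem finite_quotient_flagLattice {O : Type*} [CommRing O] {π : O} {q : ℕ} {T : ℕ → Finset O}
    (hT : IsResidueSystem π q T) (c a b : ℕ) (σ : Equiv.Perm (Fin 3)) (y z g : O) :
    Finite ((Fin 3 → O) ⧸ flagLattice π c a b σ y z g) := by
  refine Finite.of_surjective
    (fun t : Fin 3 → T (c + (a + b)) => Submodule.Quotient.mk fun i => (t i : O)) fun x => ?_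
  obtain ⟨x, rfl⟩ := Submodule.Quotient.mk_surjective _ x
  choose t ht w hw using fun i => hT.exists_rep (c + (a + b)) (x i)
  refine ⟨fun i => ⟨t i, ht i⟩, ?_⟩
  refine ((Submodule.Quotient.eq _).2 ?_).symm
  refine ⟨π ^ (a + b) • w, ?_, ?_, ?_⟩
  · funext i
    simp only [Pi.sub_apply, Pi.smul_apply, smul_eq_mul, hw, pow_add]; ring
  · simp only [Pi.smul_apply, smul_eq_mul]
    exact ⟨π ^ a * (w (σ 2) - z * w (σ 0)), by ring⟩
  · simp only [Pi.smul_apply, smul_eq_mul]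
    exact ⟨(w (σ 1) - y * w (σ 0)) + g * (w (σ 2) - z * w (σ 0)), by ring⟩

theorem isFiniteIndexSubalgebra_flagLattice_iff {O : Type*} [CommRing O] [IsDomain O] {π : O}
    (hπ : π ≠ 0) {q : ℕ} {T : ℕ → Finset O} (hT : IsResidueSystem π q T)
    {c a b : ℕ} {σ : Equiv.Perm (Fin 3)} {y z g : O} :
    IsFiniteIndexSubalgebra (flagLattice π c a b σ y z g) ↔ IsMulClosedParam π c a b y z g :=
  ⟨fun h => (mul_mem_flagLattice_iff hπ).1 h.mul_mem, fun h =>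
    ⟨finite_quotient_flagLattice hT c a b σ y z g, (mul_mem_flagLattice_iff hπ).2 h⟩⟩

/-! ### Every lattice of the given type lies in a Bruhat cell -/

theorem elementaryDivisorMatrix_three {O : Type*} [CommRing O] (π : O)
    (r : ({1, 2} : Finset ℕ) → ℕ+) : elementaryDivisorMatrix π 3 {1, 2} r =
      Matrix.diagonal ![π ^ ((r ⟨1, by simp⟩ : ℕ) + r ⟨2, by simp⟩),
        π ^ (r ⟨2, by simp⟩ : ℕ), 1] := by
  have hu : (Finset.univ : Finset ({1, 2} : Finset ℕ)) = {⟨1, by simp⟩, ⟨2, by simp⟩} := by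
    decide
  rw [elementaryDivisorMatrix]
  congr 1
  funext i
  rw [hu, Finset.sum_pair (by simp)]
  fin_cases i <;> simp

theorem hasElementaryDivisorType_three_iff {O : Type*} [CommRing O] (π : O)
    (L : Submodule O (Fin 3 → O)) (c : ℕ) (r : ({1, 2} : Finset ℕ) → ℕ+) :
    HasElementaryDivisorType π L {1, 2} c r ↔ ∃ A : GL (Fin 3) O, ∀ x, x ∈ L ↔
      ∃ t : Fin 3 → O, x = π ^ c • fun j =>
        π ^ ((r ⟨1, by simp⟩ : ℕ) + r ⟨2, by simp⟩) * t 0 * A 0 j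
          + π ^ (r ⟨2, by simp⟩ : ℕ) * t 1 * A 1 j + t 2 * A 2 j := by
  refine exists_congr fun A => ?_
  rw [SetLike.ext_iff]
  refine forall_congr' fun x => ?_
  rw [Submodule.mem_span_range_iff_exists_fun, elementaryDivisorMatrix_three]
  have : ∀ t : Fin 3 → O, (∑ i, t i • (π ^ c • (Matrix.diagonal
      ![π ^ ((r ⟨1, by simp⟩ : ℕ) + r ⟨2, by simp⟩), π ^ (r ⟨2, by simp⟩ : ℕ), 1] *
        (A : Matrix (Fin 3) (Fin 3) O))).row i) = π ^ c • fun j =>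
        π ^ ((r ⟨1, by simp⟩ : ℕ) + r ⟨2, by simp⟩) * t 0 * A 0 j
          + π ^ (r ⟨2, by simp⟩ : ℕ) * t 1 * A 1 j + t 2 * A 2 j := by
    intro t
    funext j
    simp only [Fin.sum_univ_three, Matrix.row, Pi.add_apply, Pi.smul_apply, smul_eq_mul,
      Matrix.smul_apply, Matrix.diagonal_mul, Matrix.cons_val]
    ring
  simp only [this, eq_comm]

theorem hasElementaryDivisorType_flagLattice {O : Type*} [CommRing O] (π : O) (c : ℕ)
    (r : ({1, 2} : Finset ℕ) → ℕ+) (σ : Equiv.Perm (Fin 3)) (y z g : O) :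
    HasElementaryDivisorType π
      (flagLattice π c (r ⟨1, by simp⟩) (r ⟨2, by simp⟩) σ y z g) {1, 2} c r := by
  rw [hasElementaryDivisorType_three_iff]
  -- The rows, scaled by π^(a+b), π^b and 1, generate the lattice up to π^c; before its columns are
  -- permuted the matrix has determinant 1.
  have hdet : IsUnit (Matrix.det (!![0, 1, 0; 0, -g, 1; 1, y, z].submatrix id σ.symm)) := by
    rw [Matrix.det_permute', Matrix.det_fin_three]
    refine IsUnit.mul ?_ (by simp)
    exact (Equiv.Perm.sign σ.symm).isUnit.map (Int.castRingHom O)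
  refine ⟨Matrix.nonsingInvUnit _ hdet, fun x => ?_⟩
  generalize (r ⟨1, by simp⟩ : ℕ) = a
  generalize (r ⟨2, by simp⟩ : ℕ) = b
  have hA : ((Matrix.nonsingInvUnit _ hdet : GL (Fin 3) O) : Matrix (Fin 3) (Fin 3) O) =
    !![0, 1, 0; 0, -g, 1; 1, y, z].submatrix id σ.symm := rfl
  rw [mem_flagLattice]
  simp only [hA, Matrix.submatrix_apply, id]
  constructor
  · rintro ⟨u, rfl, ⟨k, hk⟩, ⟨l, hl⟩⟩
    refine ⟨![l, k, u (σ 0)], ?_⟩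
    congr 1
    rw [perm_funext_iff σ]
    simp
    refine ⟨?_, ?_⟩
    · linear_combination hl - g * hk
    · linear_combination hk
  · rintro ⟨t, rfl⟩
    refine ⟨_, rfl, ?_⟩
    simp
    refine ⟨⟨t 1, by ring⟩, ⟨t 0, by ring⟩⟩

/-- Dividing the first form by the unit p normalises it. Since it already vanishes modulo π^b, it
can be used to eliminate U from the second form, leaving a unit multiple of V. -/
theorem dvd_linear_iff {O : Type*} [CommRing O] {π p q r s U V p' : O} {a b : ℕ}
    (hp : p * p' = 1) (hd : IsUnit (p * s - q * r)) :
    (π ^ (a + b) ∣ p * U + q * V ∧ π ^ b ∣ r * U + s * V) ↔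
      π ^ b ∣ V ∧ π ^ (a + b) ∣ U + q * p' * V := by
  have hpu : IsUnit p := IsUnit.of_mul_eq_one _ hp
  have h1 : p * U + q * V = p * (U + q * p' * V) := by linear_combination (- q * V) * hp
  have h2 : p * (r * U + s * V) = r * (p * U + q * V) + (p * s - q * r) * V := by ring
  rw [h1, hpu.dvd_mul_left, and_comm]
  refine and_congr_left fun h => ?_
  rw [← hpu.dvd_mul_left, h2, h1, ← hd.dvd_mul_left (a := π ^ b) (b := V)]
  refine dvd_add_right ?_
  exact dvd_mul_of_dvd_right (dvd_mul_of_dvd_right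
    ((pow_dvd_pow _ (Nat.le_add_left b a)).trans h) _) _

/-- The normalisation of the parameters of `flagLattice` in the Bruhat cell of `σ`. -/
def IsCellParam {O : Type*} [CommRing O] (π : O) (σ : Equiv.Perm (Fin 3)) (y z g : O) : Prop :=
  (σ 1 < σ 0 → π ∣ y) ∧ (σ 2 < σ 0 → π ∣ z) ∧ (σ 2 < σ 1 → π ∣ g)

theorem exists_pivot {O : Type*} [CommRing O] [IsDomain O] [IsDiscreteValuationRing O] {π : O}
    (hπ : Irreducible π) (v w : Fin 3 → O) (h : v 0 * w 0 + v 1 * w 1 + v 2 * w 2 = 1) :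
    ∃ i, IsUnit (v i) ∧ ∀ j < i, π ∣ v j := by
  by_cases h0 : π ∣ v 0
  · by_cases h1 : π ∣ v 1
    · by_cases h2 : π ∣ v 2
      · refine absurd (isUnit_of_dvd_one ?_) hπ.not_isUnit
        rw [← h]
        exact dvd_add (dvd_add (dvd_mul_of_dvd_left h0 _) (dvd_mul_of_dvd_left h1 _))
          (dvd_mul_of_dvd_left h2 _)
      · refine ⟨2, (not_dvd_iff_isUnit hπ _).1 h2, fun j hj => ?_⟩
        fin_cases j
        exacts [h0, h1, absurd hj (lt_irrefl _)]
    · refine ⟨1, (not_dvd_iff_isUnit hπ _).1 h1, fun j hj => ?_⟩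
      fin_cases j
      exacts [h0, absurd hj (lt_irrefl _), absurd hj (by decide)]
  · refine ⟨0, (not_dvd_iff_isUnit hπ _).1 h0, fun j hj => ?_⟩
    exact absurd hj (by simp)

theorem exists_perm_fin_three (i j k : Fin 3) (hij : i ≠ j) (hik : i ≠ k) (hjk : j ≠ k) :
    ∃ σ : Equiv.Perm (Fin 3), σ 0 = i ∧ σ 1 = j ∧ σ 2 = k := by
  revert i j k; decide

theorem sum_fin_three_perm {M : Type*} [AddCommMonoid M] (σ : Equiv.Perm (Fin 3))
    (f : Fin 3 → M) : ∑ i, f i = f (σ 0) + f (σ 1) + f (σ 2) := by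
  rw [← Equiv.sum_comp σ f, Fin.sum_univ_three]

/-- With B = A⁻¹, the vector π^c u lies in L iff the first two entries of uB are divisible by
π^(a+b) and π^b. The coordinate σ 0 is the first unit in the last row of A, and σ 1 is the first of
the other two at which column 0 of B is a unit. Taking the first in each case is what yields the
divisibilities defining the cell. -/
theorem exists_flagLattice_eq {O : Type*} [CommRing O] [IsDomain O] [IsDiscreteValuationRing O]
    {π : O} (hπ : Irreducible π) {L : Submodule O (Fin 3 → O)} {c : ℕ}
    {r : ({1, 2} : Finset ℕ) → ℕ+} (h : HasElementaryDivisorType π L {1, 2} c r) :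
    ∃ σ y z g, IsCellParam π σ y z g ∧
      L = flagLattice π c (r ⟨1, by simp⟩) (r ⟨2, by simp⟩) σ y z g := by
  rw [hasElementaryDivisorType_three_iff] at h
  obtain ⟨A, hA⟩ := h
  generalize (r ⟨1, by simp⟩ : ℕ) = a at hA ⊢
  generalize (r ⟨2, by simp⟩ : ℕ) = b at hA ⊢
  obtain ⟨B, hB⟩ : ∃ B : Matrix (Fin 3) (Fin 3) O, B = ((A⁻¹ : GL (Fin 3) O) :
    Matrix (Fin 3) (Fin 3) O) := ⟨_, rfl⟩
  have hAB : (A : Matrix (Fin 3) (Fin 3) O) * B = 1 := by rw [hB]; exact A.mul_inv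
  have hBA : B * (A : Matrix (Fin 3) (Fin 3) O) = 1 := by rw [hB]; exact A.inv_mul
  generalize (A : Matrix (Fin 3) (Fin 3) O) = A at hA hAB hBA
  -- membership in terms of the columns of `B`
  have hmem : ∀ x, x ∈ L ↔ ∃ u : Fin 3 → O, x = π ^ c • u ∧
      π ^ (a + b) ∣ ∑ j, u j * B j 0 ∧ π ^ b ∣ ∑ j, u j * B j 1 := by
    intro x
    rw [hA]
    constructor
    · rintro ⟨t, rfl⟩
      refine ⟨_, rfl, ?_⟩
      have e : (fun j => π ^ (a + b) * t 0 * A 0 j + π ^ b * t 1 * A 1 j + t 2 * A 2 j)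
          = Matrix.vecMul ![π ^ (a + b) * t 0, π ^ b * t 1, t 2] A := by
        funext j
        simp [Matrix.vecMul, dotProduct, Fin.sum_univ_three]
      have e' : ∀ i, ∑ j, (π ^ (a + b) * t 0 * A 0 j + π ^ b * t 1 * A 1 j + t 2 * A 2 j) * B j i
          = ![π ^ (a + b) * t 0, π ^ b * t 1, t 2] i := by
        intro i
        have := congrFun (Matrix.vecMul_vecMul ![π ^ (a + b) * t 0, π ^ b * t 1, t 2] A B) i
        rw [hAB, Matrix.vecMul_one, ← e] at this
        exact this
      rw [e', e']
      exact ⟨⟨t 0, rfl⟩, ⟨t 1, rfl⟩⟩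
    · rintro ⟨u, rfl, ⟨k, hk⟩, ⟨l, hl⟩⟩
      refine ⟨![k, l, ∑ j, u j * B j 2], ?_⟩
      congr 1
      funext j
      have := congrFun (Matrix.vecMul_vecMul u B A) j
      rw [hBA, Matrix.vecMul_one] at this
      rw [← this]
      simp only [Matrix.cons_val]
      rw [← hk, ← hl]
      simp [Matrix.vecMul, dotProduct, Fin.sum_univ_three]
  have hAB' : ∀ i j, ∑ k, A i k * B k j = (1 : Matrix (Fin 3) (Fin 3) O) i j := by
    intro i j; rw [← hAB, Matrix.mul_apply]
  obtain ⟨i, hi, hlt⟩ := exists_pivot hπ (A 2) (fun j => B j 2) (by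
    have := hAB' 2 2
    rwa [Fin.sum_univ_three, Matrix.one_apply_eq] at this)
  obtain ⟨v', hv'⟩ := hi.exists_right_inv
  -- the main computation, for an enumeration `i, j, k` of the coordinates
  have main : ∀ σ : Equiv.Perm (Fin 3), σ 0 = i → ∀ p', B (σ 1) 0 * p' = 1 →
      (σ 2 < σ 1 → π ∣ B (σ 2) 0 * p') →
      ∃ σ y z g, IsCellParam π σ y z g ∧ L = flagLattice π c a b σ y z g := by
    rintro σ rfl p' hp' hlt'
    refine ⟨σ, A 2 (σ 1) * v', A 2 (σ 2) * v', B (σ 2) 0 * p', ⟨fun h => ?_, fun h => ?_, hlt'⟩, ?_⟩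
    · exact dvd_mul_of_dvd_left (hlt _ h) _
    · exact dvd_mul_of_dvd_left (hlt _ h) _
    -- Columns 0 and 1 of B are orthogonal to the last row of A, whose entry at σ 0 is a unit; this
    -- eliminates the coefficient of B at row σ 0.
    have hs : ∀ (u : Fin 3 → O) (m : Fin 3), (1 : Matrix (Fin 3) (Fin 3) O) 2 m = 0 →
        ∑ j, u j * B j m = B (σ 1) m * (u (σ 1) - A 2 (σ 1) * v' * u (σ 0))
          + B (σ 2) m * (u (σ 2) - A 2 (σ 2) * v' * u (σ 0)) := by
      intro u m hm
      have h0 := hAB' 2 m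
      rw [hm, sum_fin_three_perm σ] at h0
      rw [sum_fin_three_perm σ]
      linear_combination v' * u (σ 0) * h0 - u (σ 0) * B (σ 0) m * hv'
    have h00 := hAB' 0 0
    have h01 := hAB' 0 1
    have h10 := hAB' 1 0
    have h11 := hAB' 1 1
    rw [hs _ _ (by simp)] at h00 h01 h10 h11
    simp only [Matrix.one_apply, Fin.isValue, ↓reduceIte, zero_ne_one, one_ne_zero] at h00 h01 h10 h11
    -- The inverse determinant comes from the first two rows of A after their σ 0 entries are
    -- cleared with the last row.
    have hd : IsUnit (B (σ 1) 0 * B (σ 2) 1 - B (σ 2) 0 * B (σ 1) 1) := by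
      refine IsUnit.of_mul_eq_one ((A 0 (σ 1) - A 2 (σ 1) * v' * A 0 (σ 0)) *
        (A 1 (σ 2) - A 2 (σ 2) * v' * A 1 (σ 0)) - (A 0 (σ 2) - A 2 (σ 2) * v' * A 0 (σ 0)) *
        (A 1 (σ 1) - A 2 (σ 1) * v' * A 1 (σ 0))) ?_
      generalize A 0 (σ 1) - A 2 (σ 1) * v' * A 0 (σ 0) = U1 at *
      generalize A 0 (σ 2) - A 2 (σ 2) * v' * A 0 (σ 0) = U2 at *
      generalize A 1 (σ 1) - A 2 (σ 1) * v' * A 1 (σ 0) = V1 at *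
      generalize A 1 (σ 2) - A 2 (σ 2) * v' * A 1 (σ 0) = V2 at *
      linear_combination (B (σ 1) 1 * V1 + B (σ 2) 1 * V2) * h00 + h11
        - (B (σ 1) 1 * U1 + B (σ 2) 1 * U2) * h10
    ext x
    rw [hmem, mem_flagLattice]
    refine exists_congr fun u => and_congr_right fun _ => ?_
    rw [hs u 0 (by simp), hs u 1 (by simp), dvd_linear_iff hp' hd]
  obtain ⟨j, k, hjk, hij, hik⟩ : ∃ j k : Fin 3, j < k ∧ i ≠ j ∧ i ≠ k := by
    clear * -
    revert i; decide
  by_cases hj : π ∣ B j 0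
  · have hk : ¬ π ∣ B k 0 := by
      intro hk
      have h0 := hAB' 0 0
      have h2 := hAB' 2 0
      obtain ⟨σ, rfl, rfl, rfl⟩ := exists_perm_fin_three i j k hij hik hjk.ne
      rw [sum_fin_three_perm σ] at h0 h2
      simp only [Matrix.one_apply, Fin.isValue, ↓reduceIte, Fin.reduceEq] at h0 h2
      refine hπ.not_isUnit (isUnit_of_dvd_one ?_)
      have e : (1 : O) = (A 0 (σ 1) - A 0 (σ 0) * v' * A 2 (σ 1)) * B (σ 1) 0 +
          (A 0 (σ 2) - A 0 (σ 0) * v' * A 2 (σ 2)) * B (σ 2) 0 := by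
        linear_combination -h0 + A 0 (σ 0) * v' * h2 - A 0 (σ 0) * B (σ 0) 0 * hv'
      rw [e]
      exact dvd_add (dvd_mul_of_dvd_right hj _) (dvd_mul_of_dvd_right hk _)
    obtain ⟨p', hp'⟩ := ((not_dvd_iff_isUnit hπ _).1 hk).exists_right_inv
    obtain ⟨σ, h0, h1, h2⟩ := exists_perm_fin_three i k j hik hij hjk.ne'
    exact main σ h0 p' (by rw [h1, hp']) fun _ => by
      rw [h2]; exact dvd_mul_of_dvd_left hj _
  · obtain ⟨p', hp'⟩ := ((not_dvd_iff_isUnit hπ _).1 hj).exists_right_inv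
    obtain ⟨σ, h0, h1, h2⟩ := exists_perm_fin_three i j k hij hik hjk.ne
    exact main σ h0 p' (by rw [h1, hp']) fun h => by
      rw [h1, h2] at h; exact absurd h hjk.not_gt

/-! ### Uniqueness of the parameters -/

/-- A change of z by a multiple of π^b shifts the second defining form by g(z' - z), which need not
vanish modulo π^(a+b); y has to compensate for it. -/
theorem flagLattice_congr {O : Type*} [CommRing O] {π : O} {c a b : ℕ} {σ : Equiv.Perm (Fin 3)}
    {y z g y' z' g' : O} (hz : π ^ b ∣ z' - z) (hg : π ^ a ∣ g' - g)
    (hy : π ^ (a + b) ∣ (y' - y) + g * (z' - z)) :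
    flagLattice π c a b σ y z g = flagLattice π c a b σ y' z' g' := by
  obtain ⟨k, hk⟩ := hz
  obtain ⟨l, hl⟩ := hg
  obtain ⟨m, hm⟩ := hy
  ext x
  rw [mem_flagLattice, mem_flagLattice]
  refine exists_congr fun u => and_congr_right fun _ => ?_
  have h1 : u (σ 2) - z' * u (σ 0) = (u (σ 2) - z * u (σ 0)) - π ^ b * (k * u (σ 0)) := by
    linear_combination -u (σ 0) * hk
  rw [h1, dvd_sub_left (dvd_mul_right _ _)]
  refine and_congr_right ?_
  rintro ⟨n, hn⟩
  have h2 : u (σ 1) - y' * u (σ 0) + g' * (u (σ 2) - z * u (σ 0) - π ^ b * (k * u (σ 0)))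
      = (u (σ 1) - y * u (σ 0) + g * (u (σ 2) - z * u (σ 0)))
        + π ^ (a + b) * (l * n - l * k * u (σ 0) - m * u (σ 0)) := by
    rw [pow_add] at hm ⊢
    linear_combination (-u (σ 0)) * hm + π ^ b * (n - k * u (σ 0)) * hl +
      (g' - g) * hn + g * u (σ 0) * hk
  rw [h2, dvd_add_left (dvd_mul_right _ _)]

theorem flagLattice_inj_params {O : Type*} [CommRing O] [IsDomain O] {π : O} (hπ : π ≠ 0)
    {c a b : ℕ} {σ : Equiv.Perm (Fin 3)} {y z g y' z' g' : O}
    (h : flagLattice π c a b σ y z g = flagLattice π c a b σ y' z' g') :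
    π ^ b ∣ z' - z ∧ π ^ a ∣ g' - g ∧ π ^ (a + b) ∣ (y' - y) + g * (z' - z) := by
  have hv : π ^ c • permVec σ 1 y' z' ∈ flagLattice π c a b σ y z g := by
    rw [h, smul_mem_flagLattice hπ]; simp
  have hw : π ^ c • permVec σ 0 (-g' * π ^ b) (π ^ b) ∈ flagLattice π c a b σ y z g := by
    rw [h, smul_mem_flagLattice hπ]; simp
  rw [smul_mem_flagLattice hπ] at hv hw
  simp only [permVec_zero, permVec_one, permVec_two, mul_one, mul_zero, sub_zero] at hv hw
  refine ⟨hv.1, ?_, hv.2⟩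
  refine (mul_dvd_mul_iff_right (pow_ne_zero b hπ)).1 ?_
  rw [← pow_add, ← dvd_neg]
  convert hw.2 using 1; ring

/-- Since b ≥ 1, such a vector u is modulo π a multiple of (1, y, z), placed in the coordinates σ 0,
σ 1, σ 2. The cell conditions make the entries before σ 0 vanish. -/
theorem dvd_apply_of_smul_mem_flagLattice {O : Type*} [CommRing O] [IsDomain O]
    {π : O} (hπ : π ≠ 0) {c a b : ℕ} (hb : 1 ≤ b) {σ : Equiv.Perm (Fin 3)} {y z g : O}
    (hc : IsCellParam π σ y z g) {u : Fin 3 → O}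
    (hu : π ^ c • u ∈ flagLattice π c a b σ y z g) {i : Fin 3} (hi : i < σ 0) : π ∣ u i := by
  rw [smul_mem_flagLattice hπ] at hu
  have h2 : π ∣ u (σ 2) - z * u (σ 0) := (dvd_pow_self _ (by omega)).trans hu.1
  have h1 : π ∣ u (σ 1) - y * u (σ 0) :=
    (dvd_add_left (dvd_mul_of_dvd_right h2 _)).1 ((dvd_pow_self _ (by omega)).trans hu.2)
  obtain ⟨j, rfl⟩ := σ.surjective i
  fin_cases j
  · exact absurd hi (lt_irrefl _)
  · exact (dvd_sub_left (dvd_mul_of_dvd_left (hc.1 hi) _)).1 h1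
  · exact (dvd_sub_left (dvd_mul_of_dvd_left (hc.2.1 hi) _)).1 h2

/-- The reduction modulo π is a line whose first nonzero coordinate is σ 0, so σ 0 is determined. If
σ 1 and σ 2 were exchanged, the two parameters would satisfy g g' ≡ 1 modulo π^a, whereas the cell
condition puts π into one of them. -/
theorem flagLattice_inj_perm {O : Type*} [CommRing O] [IsDomain O] {π : O} (hπ : Irreducible π)
    {c a b : ℕ} (ha : 1 ≤ a) (hb : 1 ≤ b) {σ σ' : Equiv.Perm (Fin 3)} {y z g y' z' g' : O}
    (hc : IsCellParam π σ y z g) (hc' : IsCellParam π σ' y' z' g')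
    (h : flagLattice π c a b σ y z g = flagLattice π c a b σ' y' z' g') : σ = σ' := by
  have hle : ∀ {σ σ' : Equiv.Perm (Fin 3)} {y z g y' z' g' : O}, IsCellParam π σ y z g →
      flagLattice π c a b σ y z g = flagLattice π c a b σ' y' z' g' → σ 0 ≤ σ' 0 := by
    intro σ σ' y z g y' z' g' hc h
    by_contra! hlt
    have hv : π ^ c • permVec σ' 1 y' z' ∈ flagLattice π c a b σ y z g := by
      rw [h, smul_mem_flagLattice hπ.ne_zero]; simp
    have := dvd_apply_of_smul_mem_flagLattice hπ.ne_zero hb hc hv hlt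
    rw [permVec_zero] at this
    exact hπ.not_isUnit (isUnit_of_dvd_one this)
  have h0 : σ 0 = σ' 0 := le_antisymm (hle hc h) (hle hc' h.symm)
  by_contra hne
  obtain ⟨h12, h21⟩ : σ' 1 = σ 2 ∧ σ' 2 = σ 1 := by
    clear * - h0 hne
    revert σ σ'; decide
  have hv : π ^ c • permVec σ 0 (-g * π ^ b) (π ^ b) ∈ flagLattice π c a b σ' y' z' g' := by
    rw [← h, smul_mem_flagLattice hπ.ne_zero]; simp
  rw [smul_mem_flagLattice hπ.ne_zero, ← h0, h12, h21] at hv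
  simp only [permVec_zero, permVec_one, permVec_two, mul_zero, sub_zero] at hv
  have h3 : π ∣ g * g' := by
    rcases lt_or_gt_of_ne (σ.injective.ne (show (1 : Fin 3) ≠ 2 by decide)) with hlt | hlt
    · exact dvd_mul_of_dvd_right (hc'.2.2 (by rwa [h12, h21])) _
    · exact dvd_mul_of_dvd_left (hc.2.2 hlt) _
  have h4 : π ^ a ∣ 1 - g * g' := by
    refine (mul_dvd_mul_iff_right (pow_ne_zero b hπ.ne_zero)).1 ?_
    rw [← pow_add]
    convert hv.2 using 1; ring
  have h5 : π ∣ 1 - g * g' := (dvd_pow_self _ (by omega)).trans h4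
  exact hπ.not_isUnit (isUnit_of_dvd_one ((dvd_sub_left h3).1 h5))

open Classical in
theorem subalgebraCount_eq_sum {O : Type*} [CommRing O] [IsDomain O] [IsDiscreteValuationRing O]
    {π : O} (hπ : Irreducible π) {q : ℕ} {T : ℕ → Finset O} (hT : IsResidueSystem π q T)
    (c : ℕ) (r : ({1, 2} : Finset ℕ) → ℕ+) {a b : ℕ} (ha : (r ⟨1, by simp⟩ : ℕ) = a)
    (hb : (r ⟨2, by simp⟩ : ℕ) = b) :
    subalgebraCount π 3 {1, 2} c r = ∑ σ : Equiv.Perm (Fin 3),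
      ((T (a + b) ×ˢ T b ×ˢ T a).filter fun p =>
        IsCellParam π σ p.1 p.2.1 p.2.2 ∧ IsMulClosedParam π c a b p.1 p.2.1 p.2.2).card := by
  have ha1 : 1 ≤ a := ha ▸ (r ⟨1, by simp⟩).pos
  have hb1 : 1 ≤ b := hb ▸ (r ⟨2, by simp⟩).pos
  rw [← Finset.card_sigma, ← Set.ncard_coe_finset, subalgebraCount]
  rw [← Set.InjOn.ncard_image (f := fun s : (_ : Equiv.Perm (Fin 3)) × O × O × O =>
    flagLattice π c a b s.1 s.2.1 s.2.2.1 s.2.2.2)]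
  · congr 1
    ext L
    simp only [Set.mem_ofPred_eq, Set.mem_image, Finset.mem_coe, Finset.mem_sigma,
      Finset.mem_univ, Finset.mem_filter, Finset.mem_product, true_and, Sigma.exists,
      Prod.exists]
    constructor
    · rintro ⟨h1, h2⟩
      obtain ⟨σ, y, z, g, hc, rfl⟩ := exists_flagLattice_eq hπ h2
      rw [ha, hb] at h1 ⊢
      obtain ⟨z', hz', hzz⟩ := hT.exists_rep b z
      obtain ⟨g', hg', hgg⟩ := hT.exists_rep a g
      -- The representative is taken of the value of y corrected for the replacement of z by z'.
      obtain ⟨y', hy', hyy⟩ := hT.exists_rep (a + b) (y - g * (z' - z))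
      have he : flagLattice π c a b σ y z g = flagLattice π c a b σ y' z' g' := by
        refine flagLattice_congr ((dvd_sub_comm).1 hzz) ((dvd_sub_comm).1 hgg) ?_
        rw [← dvd_neg]
        convert hyy using 1; ring
      have hz1 : π ∣ z - z' := (dvd_pow_self _ (by omega)).trans hzz
      have hg1 : π ∣ g - g' := (dvd_pow_self _ (by omega)).trans hgg
      have hy1 : π ∣ y - y' := by
        have h3 : π ∣ y - g * (z' - z) - y' := (dvd_pow_self _ (by omega)).trans hyy
        have e : y - y' = (y - g * (z' - z) - y') - g * (z - z') := by ring
        rw [e]; exact dvd_sub h3 (dvd_mul_of_dvd_right hz1 _)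
      refine ⟨σ, y', z', g', ⟨⟨hy', hz', hg'⟩, ⟨fun h => ?_, fun h => ?_, fun h => ?_⟩, ?_⟩,
        he.symm⟩
      · exact (dvd_iff_dvd_of_dvd_sub hy1).1 (hc.1 h)
      · exact (dvd_iff_dvd_of_dvd_sub hz1).1 (hc.2.1 h)
      · exact (dvd_iff_dvd_of_dvd_sub hg1).1 (hc.2.2 h)
      · rw [he] at h1
        exact (isFiniteIndexSubalgebra_flagLattice_iff hπ.ne_zero hT).1 h1
    · rintro ⟨σ, y, z, g, ⟨-, -, h⟩, rfl⟩
      refine ⟨(isFiniteIndexSubalgebra_flagLattice_iff hπ.ne_zero hT).2 h, ?_⟩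
      rw [← ha, ← hb]
      exact hasElementaryDivisorType_flagLattice π c r σ y z g
  · rintro ⟨σ, y, z, g⟩ h1 ⟨σ', y', z', g'⟩ h2 h
    simp only [Finset.mem_coe, Finset.mem_sigma, Finset.mem_univ, Finset.mem_filter,
      Finset.mem_product, true_and] at h1 h2
    obtain ⟨⟨hy, hz, hg⟩, hc, -⟩ := h1
    obtain ⟨⟨hy', hz', hg'⟩, hc', -⟩ := h2
    dsimp only at h hy hz hg hy' hz' hg'
    obtain rfl := flagLattice_inj_perm hπ ha1 hb1 hc hc' h
    obtain ⟨k1, k2, k3⟩ := flagLattice_inj_params hπ.ne_zero h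
    obtain rfl := hT.eq_of_dvd _ _ hz' _ hz k1
    obtain rfl := hT.eq_of_dvd _ _ hg' _ hg k2
    rw [sub_self, mul_zero, add_zero] at k3
    obtain rfl := hT.eq_of_dvd _ _ hy' _ hy k3
    rfl

/-! ### Eliminating one parameter -/

theorem card_filter_product_eq_mul {α β : Type*} (S : Finset α) (U : Finset β)
    (P : α × β → Prop) (Q : β → Prop) [DecidablePred P] [DecidablePred Q] (N : ℕ)
    (p : β → α → Prop) [∀ u, DecidablePred (p u)]
    (hP : ∀ s ∈ S, ∀ u ∈ U, P (s, u) ↔ Q u ∧ p u s)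
    (hN : ∀ u ∈ U, Q u → (S.filter (p u)).card = N) :
    ((S ×ˢ U).filter P).card = N * (U.filter Q).card := by
  classical
  rw [Finset.card_filter, Finset.sum_product_right, Finset.card_filter, Finset.mul_sum]
  refine Finset.sum_congr rfl fun u hu => ?_
  split_ifs with h
  · rw [mul_one, ← hN u hu h, Finset.card_filter]
    refine Finset.sum_congr rfl fun s hs => ?_
    simp [hP s hs u hu, h]
  · rw [mul_zero]
    refine Finset.sum_eq_zero fun s hs => ?_
    simp [hP s hs u hu, h]

theorem card_filter_product_eq_mul' {α β : Type*} (S : Finset α) (U : Finset β)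
    (P : α × β → Prop) (p : α → Prop) (Q : β → Prop) [DecidablePred P] [DecidablePred Q]
    [DecidablePred p] (hP : ∀ s ∈ S, ∀ u ∈ U, P (s, u) ↔ p s ∧ Q u) :
    ((S ×ˢ U).filter P).card = (S.filter p).card * (U.filter Q).card :=
  card_filter_product_eq_mul S U P Q _ (fun _ => p)
    (fun s hs u hu => by rw [hP s hs u hu, and_comm]) fun _ _ _ => rfl

open Classical in
/-- The number of parameters of multiplicatively closed lattices subject to conditions on each of
the three parameters. -/
noncomputable def boxCount {O : Type*} [CommRing O] (π : O) (T : ℕ → Finset O) (c a b : ℕ)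
    (Py Pz Pg : O → Prop) : ℕ :=
  ((T (a + b) ×ˢ T b ×ˢ T a).filter fun p =>
    (Py p.1 ∧ Pz p.2.1 ∧ Pg p.2.2) ∧ IsMulClosedParam π c a b p.1 p.2.1 p.2.2).card

/-- `y` is congruent neither to `0` nor to `1`. -/
def IsGeneric {O : Type*} [CommRing O] (π y : O) : Prop := ¬ π ∣ y - 0 ∧ ¬ π ∣ y - 1

section

variable {O : Type*} [CommRing O] [IsDomain O] [IsDiscreteValuationRing O] {π : O}

theorem generic_trichotomy {O : Type*} [CommRing O] {π : O} (hπ : Irreducible π) (y : O) :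
    (π ∣ y - 0 ∧ ¬ π ∣ y - 1 ∧ ¬ IsGeneric π y) ∨ (¬ π ∣ y - 0 ∧ π ∣ y - 1 ∧ ¬ IsGeneric π y) ∨
      (¬ π ∣ y - 0 ∧ ¬ π ∣ y - 1 ∧ IsGeneric π y) := by
  have : ¬ (π ∣ y - 0 ∧ π ∣ y - 1) := by
    rintro ⟨h0, h1⟩
    refine hπ.not_isUnit (isUnit_of_dvd_one ?_)
    convert dvd_sub h0 h1 using 1; ring
  unfold IsGeneric
  tauto

theorem boxCount_split_left {O : Type*} [CommRing O] {π : O} (hπ : Irreducible π) (T : ℕ → Finset O) (c a b : ℕ)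
    (Pz Pg : O → Prop) : boxCount π T c a b (fun _ => True) Pz Pg =
      boxCount π T c a b (fun y => π ∣ y - 0) Pz Pg + boxCount π T c a b (fun y => π ∣ y - 1) Pz Pg
        + boxCount π T c a b (IsGeneric π) Pz Pg := by
  simp only [boxCount, Finset.card_filter, ← Finset.sum_add_distrib]
  refine Finset.sum_congr rfl fun p _ => ?_
  rcases generic_trichotomy hπ p.1 with ⟨h0, h1, h2⟩ | ⟨h0, h1, h2⟩ | ⟨h0, h1, h2⟩ <;>
    split_ifs <;> first | rfl | (exfalso; tauto)

theorem boxCount_split_mid {O : Type*} [CommRing O] {π : O} (hπ : Irreducible π) (T : ℕ → Finset O) (c a b : ℕ)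
    (Py Pg : O → Prop) : boxCount π T c a b Py (fun _ => True) Pg =
      boxCount π T c a b Py (fun y => π ∣ y - 0) Pg + boxCount π T c a b Py (fun y => π ∣ y - 1) Pg
        + boxCount π T c a b Py (IsGeneric π) Pg := by
  simp only [boxCount, Finset.card_filter, ← Finset.sum_add_distrib]
  refine Finset.sum_congr rfl fun p _ => ?_
  rcases generic_trichotomy hπ p.2.1 with ⟨h0, h1, h2⟩ | ⟨h0, h1, h2⟩ | ⟨h0, h1, h2⟩ <;>
    split_ifs <;> first | rfl | (exfalso; tauto)

theorem isUnit_of_dvd_sub (hπ : Irreducible π) {x u : O} (hu : IsUnit u) (h : π ∣ x - u) :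
    IsUnit x := by
  rw [← not_dvd_iff_isUnit hπ]
  intro hx
  refine hπ.not_isUnit (isUnit_of_dvd_unit ?_ hu)
  convert dvd_sub hx h using 1; ring

variable {q : ℕ} {T : ℕ → Finset O} {c a b : ℕ}

/-- For y near e the first condition is solved by Hensel's lemma: y is determined modulo π^(a+b-c)
and has q^c lifts modulo π^(a+b). It remains to express the other conditions through (z, g) alone,
which is the hypothesis `hQ`. -/
theorem boxCount_near (hπ : Irreducible π) (hT : IsResidueSystem π q T) (hc : c < a + b)
    {e : O} (he : e * e = e) (Pz Pg : O → Prop) (Q : O × O → Prop) [DecidablePred Q]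
    (hQ : ∀ y z g, π ∣ y - e → π ^ (a + b - c) ∣ y * (y - 1) + g * (z * (z - 1)) →
      ((Pz z ∧ Pg g ∧ π ^ b ∣ π ^ c * (z * (z - 1)) ∧ π ^ a ∣ π ^ c * (g * (z - y)) ∧
        π ^ a ∣ π ^ (b + c) * (g * (1 + g))) ↔ Q (z, g)))
    (hQ' : ∀ z g, Q (z, g) → π ∣ g * (z * (z - 1))) :
    boxCount π T c a b (fun y => π ∣ y - e) Pz Pg = q ^ c * ((T b ×ˢ T a).filter Q).card := by
  classical
  unfold boxCount
  refine card_filter_product_eq_mul _ _ _ _ _ (fun u y => π ∣ y - e ∧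
    π ^ (a + b - c) ∣ y * (y - 1) + u.2 * (u.1 * (u.1 - 1))) ?_ ?_
  · rintro y _ ⟨z, g⟩ _
    simp only [IsMulClosedParam]
    rw [pow_dvd_pow_mul_iff_pow_sub_dvd hπ.ne_zero (a + b)]
    constructor
    · rintro ⟨⟨h1, h2, h3⟩, h4, h5⟩
      exact ⟨(hQ y z g h1 h4).1 ⟨h2, h3, h5⟩, h1, h4⟩
    · rintro ⟨h1, h2, h3⟩
      obtain ⟨h4, h5, h6⟩ := (hQ y z g h2 h3).2 h1
      exact ⟨⟨h2, h4, h5⟩, h3, h6⟩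
  · rintro ⟨z, g⟩ _ h
    rw [hT.card_filter_root hπ he (hQ' z g h) (by omega) (Nat.sub_le _ _) _ fun y => Iff.rfl]
    congr 1; omega

/-- Here z + y - 1 and z + e - 1 are units. Multiplying z - y by the former gives z(z-1) - y(y-1),
which the first condition turns into (1 + g) z(z-1), and z(z-1) is z - e up to the latter. -/
theorem boxCount_near_near (hπ : Irreducible π) (hT : IsResidueSystem π q T) (hc : c < a + b)
    {e : O} (he : e * e = e) (Pg : O → Prop) (Q : O × O → Prop) [DecidablePred Q]
    (hQ : ∀ p, Q p ↔ (π ∣ p.1 - e ∧ π ^ b ∣ π ^ c * (p.1 - e)) ∧ Pg p.2 ∧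
        π ^ a ∣ π ^ c * (p.2 * (1 + p.2) * (p.1 - e)) ∧
        π ^ a ∣ π ^ (b + c) * (p.2 * (1 + p.2))) :
    boxCount π T c a b (fun y => π ∣ y - e) (fun z => π ∣ z - e) Pg =
      q ^ c * ((T b ×ˢ T a).filter Q).card := by
  have h2e : IsUnit (2 * e - 1) := IsUnit.of_mul_eq_one (2 * e - 1) (by linear_combination 4 * he)
  refine boxCount_near hπ hT hc he _ _ _ ?_ ?_
  · intro y z g hy hC
    rw [hQ]
    dsimp only
    rw [and_assoc, and_left_comm (a := Pg g)]
    refine and_congr_right fun hz => ?_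
    have hu1 : IsUnit (z + e - 1) := isUnit_of_dvd_sub hπ h2e (by convert hz using 1; ring)
    have hu2 : IsUnit (z + y - 1) := isUnit_of_dvd_sub hπ h2e (by
      convert dvd_add hz hy using 1; ring)
    have h1 : π ^ b ∣ π ^ c * (z * (z - 1)) ↔ π ^ b ∣ π ^ c * (z - e) := by
      rw [← hu1.dvd_mul_right (b := π ^ c * (z - e))]
      refine iff_of_eq (congrArg _ ?_)
      linear_combination π ^ c * he
    have h2 : π ^ a ∣ π ^ c * (g * (z - y)) ↔ π ^ a ∣ π ^ c * (g * (1 + g) * (z - e)) := by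
      obtain ⟨s, hs⟩ := hC
      rw [← hu1.dvd_mul_right (b := π ^ c * (g * (1 + g) * (z - e))),
        ← hu2.dvd_mul_right (b := π ^ c * (g * (z - y)))]
      have hp : π ^ c * π ^ (a + b - c) = π ^ a * π ^ b := by
        rw [← pow_add, ← pow_add]; congr 1; omega
      have : π ^ c * (g * (z - y)) * (z + y - 1) =
          π ^ c * (g * (1 + g) * (z - e)) * (z + e - 1) - π ^ a * (π ^ b * g * s) := by
        linear_combination (-π ^ c * g) * hs - g * s * hp + π ^ c * g * (1 + g) * he
      rw [this, dvd_sub_left (dvd_mul_right _ _)]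
    rw [h1, h2, and_left_comm]
  · intro z g hzg
    obtain ⟨⟨hz, -⟩, -⟩ := (hQ _).1 hzg
    dsimp only at hz
    obtain ⟨s, hs⟩ := hz
    refine ⟨g * s * (z + e - 1), ?_⟩
    linear_combination g * (z + e - 1) * hs + g * he

/-- Now z - y is a unit, so the third condition constrains g alone and implies the fourth. -/
theorem boxCount_near_compl (hπ : Irreducible π) (hT : IsResidueSystem π q T) (hc : c < a + b)
    {e e' : O} (he : e * e = e) (hee : e + e' = 1) (Pg : O → Prop)
    (Q : O × O → Prop) [DecidablePred Q]
    (hQ : ∀ p, Q p ↔ (π ∣ p.1 - e' ∧ π ^ b ∣ π ^ c * (p.1 - e')) ∧ Pg p.2 ∧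
        π ^ a ∣ π ^ c * p.2) :
    boxCount π T c a b (fun y => π ∣ y - e) (fun z => π ∣ z - e') Pg =
      q ^ c * ((T b ×ˢ T a).filter Q).card := by
  obtain rfl : e' = 1 - e := by linear_combination hee
  have h2e : IsUnit (1 - 2 * e) := IsUnit.of_mul_eq_one (1 - 2 * e) (by linear_combination 4 * he)
  refine boxCount_near hπ hT hc he _ _ _ ?_ ?_
  · intro y z g hy hC
    rw [hQ]
    dsimp only
    rw [and_assoc, and_left_comm (a := Pg g)]
    refine and_congr_right fun hz => ?_
    have hu1 : IsUnit (z - e) := isUnit_of_dvd_sub hπ h2e (by convert hz using 1; ring)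
    have hu2 : IsUnit (z - y) := isUnit_of_dvd_sub hπ h2e (by
      convert dvd_sub hz hy using 1; ring)
    have h1 : π ^ b ∣ π ^ c * (z * (z - 1)) ↔ π ^ b ∣ π ^ c * (z - (1 - e)) := by
      rw [← hu1.dvd_mul_right (b := π ^ c * (z - (1 - e)))]
      refine iff_of_eq (congrArg _ ?_)
      linear_combination π ^ c * he
    have h2 : π ^ a ∣ π ^ c * (g * (z - y)) ↔ π ^ a ∣ π ^ c * g := by
      rw [← hu2.dvd_mul_right (b := π ^ c * g), mul_assoc]
    have h3 : π ^ a ∣ π ^ c * g → π ^ a ∣ π ^ (b + c) * (g * (1 + g)) := fun h => by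
      refine (dvd_mul_of_dvd_right h (π ^ b * (1 + g))).trans (dvd_of_eq ?_)
      ring
    rw [h1, h2]
    tauto
  · intro z g hzg
    obtain ⟨⟨hz, -⟩, -⟩ := (hQ _).1 hzg
    dsimp only at hz
    obtain ⟨s, hs⟩ := hz
    refine ⟨g * s * (z - e), ?_⟩
    linear_combination g * (z - e) * hs + g * he

theorem IsGeneric.isUnit_mul (hπ : Irreducible π) {z : O} (h : IsGeneric π z) :
    IsUnit (z * (z - 1)) := by
  have h1 := h.1
  have h2 := h.2
  rw [sub_zero] at h1
  rw [not_dvd_iff_isUnit hπ] at h1 h2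
  exact h1.mul h2

theorem pow_dvd_pow_iff_le {O : Type*} [CommRing O] [IsDomain O] {π : O} (hπ : Irreducible π) {m n : ℕ} : π ^ m ∣ π ^ n ↔ m ≤ n :=
  pow_dvd_pow_iff hπ.ne_zero hπ.not_isUnit

/-- As y(y-1) vanishes modulo π and z(z-1) is a unit, the first condition forces π ∣ g, and the
second forces b ≤ c. -/
theorem boxCount_near_generic (hπ : Irreducible π) (hT : IsResidueSystem π q T) (hc : c < a + b)
    {e : O} (he : e = 0 ∨ e = 1) (Pg : O → Prop) (hPg : ∀ g, π ∣ g → Pg g)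
    (Q : O × O → Prop) [DecidablePred Q]
    (hQ : ∀ p, Q p ↔ (IsGeneric π p.1 ∧ b ≤ c) ∧ π ∣ p.2 ∧ π ^ a ∣ π ^ c * p.2) :
    boxCount π T c a b (fun y => π ∣ y - e) (IsGeneric π) Pg =
      q ^ c * ((T b ×ˢ T a).filter Q).card := by
  have hee : e * e = e := by rcases he with rfl | rfl <;> simp
  refine boxCount_near hπ hT hc hee _ _ _ ?_ ?_
  · intro y z g hy hC
    rw [hQ]
    dsimp only
    rw [and_assoc]
    refine and_congr_right fun hz => ?_
    have hu := hz.isUnit_mul hπ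
    have hu2 : IsUnit (z - y) := by
      refine isUnit_of_dvd_sub hπ (u := z - e) ?_ ?_
      · rw [← not_dvd_iff_isUnit hπ]
        rcases he with rfl | rfl
        exacts [hz.1, hz.2]
      · rw [← dvd_neg]; convert hy using 1; ring
    have hg : π ∣ g := by
      have h1 : π ∣ y * (y - 1) + g * (z * (z - 1)) := (dvd_pow_self _ (by omega)).trans hC
      have h2 : π ∣ y * (y - 1) := by
        obtain ⟨s, hs⟩ := hy
        exact ⟨s * (y + e - 1), by linear_combination (y + e - 1) * hs + hee⟩
      exact hu.dvd_mul_right.1 ((dvd_add_right h2).1 h1)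
    have h1 : π ^ b ∣ π ^ c * (z * (z - 1)) ↔ b ≤ c := by
      rw [hu.dvd_mul_right, pow_dvd_pow_iff_le hπ]
    have h2 : π ^ a ∣ π ^ c * (g * (z - y)) ↔ π ^ a ∣ π ^ c * g := by
      rw [← hu2.dvd_mul_right (b := π ^ c * g), mul_assoc]
    have h3 : π ^ a ∣ π ^ c * g → π ^ a ∣ π ^ (b + c) * (g * (1 + g)) := fun h => by
      refine (dvd_mul_of_dvd_right h (π ^ b * (1 + g))).trans (dvd_of_eq ?_)
      ring
    have h4 := hPg g hg
    rw [h1, h2]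
    tauto
  · intro z g hzg
    obtain ⟨-, hg, -⟩ := (hQ _).1 hzg
    exact dvd_mul_of_dvd_left hg _

/-- The first condition fails modulo π: y(y-1) is a unit, while g z(z-1) is divisible by π. -/
theorem boxCount_generic_near (hπ : Irreducible π) (T : ℕ → Finset O) (hc : c < a + b)
    {e : O} (he : e * e = e) (Pg : O → Prop) :
    boxCount π T c a b (IsGeneric π) (fun z => π ∣ z - e) Pg = 0 := by
  classical
  rw [boxCount, Finset.card_eq_zero, Finset.filter_eq_empty_iff]
  rintro ⟨y, z, g⟩ _ ⟨⟨hy, ⟨s, hs⟩, -⟩, h, -⟩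
  dsimp only at hy hs h
  rw [pow_dvd_pow_mul_iff_pow_sub_dvd hπ.ne_zero] at h
  have h1 := (dvd_pow_self π (by omega)).trans h
  have h2 : π ∣ g * (z * (z - 1)) :=
    ⟨g * s * (z + e - 1), by linear_combination g * (z + e - 1) * hs + g * he⟩
  exact hπ.not_isUnit (isUnit_of_dvd_unit ((dvd_add_left h2).1 h1) (hy.isUnit_mul hπ))

theorem boxCount_generic_generic_dvd (hπ : Irreducible π) (T : ℕ → Finset O) (hc : c < a + b) :
    boxCount π T c a b (IsGeneric π) (IsGeneric π) (fun g => π ∣ g) = 0 := by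
  classical
  rw [boxCount, Finset.card_eq_zero, Finset.filter_eq_empty_iff]
  rintro ⟨y, z, g⟩ _ ⟨⟨hy, -, hg⟩, h, -⟩
  dsimp only at hy hg h
  rw [pow_dvd_pow_mul_iff_pow_sub_dvd hπ.ne_zero] at h
  have h1 := (dvd_pow_self π (by omega)).trans h
  exact hπ.not_isUnit (isUnit_of_dvd_unit ((dvd_add_left (dvd_mul_of_dvd_left hg _)).1 h1)
    (hy.isUnit_mul hπ))

open Classical in
-- The first condition is linear in g with unit coefficient z(z-1), so g is determined modulo
-- π^(a+b-c) and is itself a unit. The third condition becomes y ≡ z modulo π^(a-c). It implies the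
-- fourth, because (1 + g) z(z-1) ≡ -(y - z)(y + z - 1) modulo π^(a+b-c).
theorem boxCount_generic_generic (hπ : Irreducible π) (hT : IsResidueSystem π q T)
    (hc : c < a + b) (hbc : b ≤ c) :
    boxCount π T c a b (IsGeneric π) (IsGeneric π) (fun _ => True) =
      q ^ (c - b) * ((T (a + b) ×ˢ T b).filter fun p => IsGeneric π p.2 ∧
        (IsGeneric π p.1 ∧ π ^ (a - c) ∣ p.1 - p.2)).card := by
  rw [← card_filter_product_eq_mul (T a) (T (a + b) ×ˢ T b)
    (fun p => (IsGeneric π p.2.1 ∧ IsGeneric π p.2.2) ∧ IsMulClosedParam π c a b p.2.1 p.2.2 p.1)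
    _ (q ^ (c - b)) (fun u g => π ^ (a + b - c) ∣ u.1 * (u.1 - 1) + g * (u.2 * (u.2 - 1)))]
  · unfold boxCount
    refine Finset.card_bij' (fun p _ => (p.2.2, p.1, p.2.1)) (fun p _ => (p.2.1, p.2.2, p.1))
      ?_ ?_ ?_ ?_
    · rintro ⟨y, z, g⟩ h
      simp only [Finset.mem_filter, Finset.mem_product] at h ⊢
      tauto
    · rintro ⟨g, y, z⟩ h
      simp only [Finset.mem_filter, Finset.mem_product] at h ⊢
      tauto
    · intros; rfl
    · intros; rfl
  · rintro g _ ⟨y, z⟩ _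
    simp only [IsMulClosedParam]
    rw [pow_dvd_pow_mul_iff_pow_sub_dvd hπ.ne_zero (a + b)]
    by_cases hy : IsGeneric π y
    swap
    · simp [hy]
    by_cases hz : IsGeneric π z
    swap
    · simp [hz]
    simp only [hy, hz, true_and]
    rw [and_comm, and_congr_left_iff]
    intro hC
    have hu := hz.isUnit_mul hπ
    have hg : IsUnit g := by
      rw [← not_dvd_iff_isUnit hπ]
      intro hg
      have h1 := (dvd_pow_self π (by omega)).trans hC
      exact hπ.not_isUnit (isUnit_of_dvd_unit ((dvd_add_left (dvd_mul_of_dvd_left hg _)).1 h1)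
        (hy.isUnit_mul hπ))
    have h1 : π ^ b ∣ π ^ c * (z * (z - 1)) := dvd_mul_of_dvd_left (pow_dvd_pow _ hbc) _
    have h2 : π ^ a ∣ π ^ c * (g * (z - y)) ↔ π ^ (a - c) ∣ y - z := by
      rw [pow_dvd_pow_mul_iff_pow_sub_dvd hπ.ne_zero, hg.dvd_mul_left, dvd_sub_comm]
    have h3 : π ^ (a - c) ∣ y - z → π ^ a ∣ π ^ (b + c) * (g * (1 + g)) := by
      intro h
      rw [pow_add, mul_comm (π ^ b), mul_assoc, pow_dvd_pow_mul_iff_pow_sub_dvd hπ.ne_zero]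
      refine dvd_mul_of_dvd_right (dvd_mul_of_dvd_right ?_ _) _
      rw [← hu.dvd_mul_right (b := 1 + g)]
      have h4 := (pow_dvd_pow π (show a - c ≤ a + b - c by omega)).trans hC
      have h5 : (1 + g) * (z * (z - 1)) =
        (y * (y - 1) + g * (z * (z - 1))) - (y - z) * (y + z - 1) := by ring
      rw [h5]
      exact dvd_sub h4 (dvd_mul_of_dvd_left h _)
    rw [h2]
    tauto
  · rintro ⟨y, z⟩ _ ⟨hz, -, -⟩
    obtain ⟨w, hw⟩ := (hz.isUnit_mul hπ).exists_right_inv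
    dsimp only at hw
    rw [hT.card_filter_dvd_sub hπ.ne_zero (show a + b - c ≤ a by omega)
      (-(y * (y - 1)) * w) _ fun g _ => ?_]
    · congr 1; omega
    · rw [← (hz.isUnit_mul hπ).dvd_mul_right (b := g - _)]
      refine iff_of_eq (congrArg _ ?_)
      dsimp only
      linear_combination (- (y * (y - 1))) * hw

theorem boxCount_generic_generic_of_lt (hπ : Irreducible π) (T : ℕ → Finset O)
    (hbc : c < b) (Pg : O → Prop) :
    boxCount π T c a b (IsGeneric π) (IsGeneric π) Pg = 0 := by
  classical
  rw [boxCount, Finset.card_eq_zero, Finset.filter_eq_empty_iff]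
  rintro ⟨y, z, g⟩ _ ⟨⟨-, hz, -⟩, -, h, -⟩
  dsimp only at hz h
  rw [(hz.isUnit_mul hπ).dvd_mul_right, pow_dvd_pow_iff_le hπ] at h
  omega

end

/-! ### Counts as densities in v = q⁻¹ -/

theorem pow_max_dvd_iff {O : Type*} [CommRing O] {π x : O} {i j : ℕ} :
    π ^ max i j ∣ x ↔ π ^ i ∣ x ∧ π ^ j ∣ x := by
  refine ⟨fun h => ⟨(pow_dvd_pow _ (le_max_left _ _)).trans h,
    (pow_dvd_pow _ (le_max_right _ _)).trans h⟩, fun h => ?_⟩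
  rcases max_choice i j with h' | h' <;> rw [h']
  exacts [h.1, h.2]

section

variable {O : Type*} [CommRing O] [IsDomain O] [IsDiscreteValuationRing O] {π : O} {q : ℕ}
  {T : ℕ → Finset O}

theorem cast_card_filter_dvd_sub {O : Type*} [CommRing O] [IsDomain O] {π : O} {q : ℕ}
    {T : ℕ → Finset O} (hπ : Irreducible π) (hT : IsResidueSystem π q T) (hq : 1 < q)
    {j n : ℕ} (hj : j ≤ n) (x : O) (p : O → Prop) [DecidablePred p]
    (hp : ∀ t ∈ T n, p t ↔ π ^ j ∣ t - x) :
    (((T n).filter p).card : ℂ) = (q : ℂ) ^ n * (q : ℂ)⁻¹ ^ j := by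
  have hq0 : (q : ℂ) ≠ 0 := by exact_mod_cast (by omega : q ≠ 0)
  rw [hT.card_filter_dvd_sub hπ.ne_zero hj x p hp, Nat.cast_pow]
  obtain ⟨m, rfl⟩ := Nat.exists_eq_add_of_le hj
  rw [Nat.add_sub_cancel_left, pow_add, mul_right_comm, ← mul_pow, mul_inv_cancel₀ hq0, one_pow,
    one_mul]

theorem cast_card_filter_not_dvd {O : Type*} [CommRing O] [IsDomain O] {π : O} {q : ℕ}
    {T : ℕ → Finset O} (hπ : Irreducible π) (hT : IsResidueSystem π q T) (hq : 1 < q)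
    {n : ℕ} (hn : 1 ≤ n) {u v : O} (huv : IsUnit (u - v))
    (p : O → Prop) [DecidablePred p] (hp : ∀ y, p y ↔ ¬ π ∣ y - u ∧ ¬ π ∣ y - v) :
    (((T n).filter p).card : ℂ) = (q : ℂ) ^ n * (1 - 2 * (q : ℂ)⁻¹) := by
  have hq0 : (q : ℂ) ≠ 0 := by exact_mod_cast (by omega : q ≠ 0)
  have h := congrArg (Nat.cast : ℕ → ℂ) (hT.card_filter_not_dvd hπ hn huv p hp)
  obtain ⟨n, rfl⟩ := Nat.exists_eq_add_of_le' hn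
  push_cast [Nat.add_sub_cancel] at h
  rw [pow_succ] at h ⊢
  linear_combination h + 2 * (q : ℂ) ^ n * mul_inv_cancel₀ hq0

/-- The normalised number of pairs `(z, g)` with `v(z) ≥ k`, `v(g) ≥ 1`, `v(z) + v(g) ≥ d` and
`v(g) ≥ d - b`, where `z` is taken modulo `π ^ b`. -/
noncomputable def nearDensity (v : ℂ) (b k d : ℕ) : ℂ :=
  v ^ max d (k + 1) * (1 + ((min (d - 1) b - k : ℕ) : ℂ) * (1 - v))

/-- The difference is the share of pairs in which z has valuation exactly k: g then needs valuation
at least max(1, d - k). For k + 1 < d this share is v^d (1 - v) whatever k is, which explains the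
linear factor in the definition. -/
theorem nearDensity_step (v : ℂ) {b k d : ℕ} (hk : k < b) :
    nearDensity v b k d =
      nearDensity v b (k + 1) d + (v ^ k - v ^ (k + 1)) * v ^ max 1 (d - k) := by
  unfold nearDensity
  rcases le_or_gt d (k + 1) with h | h
  · rw [max_eq_right h, max_eq_right (by omega), max_eq_left (by omega),
      show min (d - 1) b - k = 0 by omega, show min (d - 1) b - (k + 1) = 0 by omega]
    push_cast; ring
  · obtain ⟨m, rfl⟩ := Nat.exists_eq_add_of_le (show k + 2 ≤ d by omega)
    obtain ⟨t, ht⟩ : ∃ t, min (k + 2 + m - 1) b - k = t + 1 :=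
      ⟨min (k + 2 + m - 1) b - k - 1, by omega⟩
    rw [max_eq_left (by omega), max_eq_left (by omega), max_eq_right (by omega), ht,
      show min (k + 2 + m - 1) b - (k + 1) = t by omega, show k + 2 + m - k = m + 2 by omega]
    push_cast; ring

/-- Downward induction on k from b. At k = b the condition v(g) ≥ d - b already implies the product
condition; a step splits off the z of valuation exactly k. -/
theorem card_near_pairs (hπ : Irreducible π) (hT : IsResidueSystem π q T) (hq : 1 < q)
    {a b d : ℕ} (ha : 1 ≤ a) (hd : d ≤ a) (e δ : O) (j : ℕ) :
    ∀ k, 1 ≤ k → k + j = b → ∀ (P : O × O → Prop) [DecidablePred P],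
      (∀ p, P p ↔ π ^ k ∣ p.1 - e ∧ π ∣ p.2 - δ ∧ π ^ d ∣ (p.2 - δ) * (p.1 - e) ∧
        π ^ (d - b) ∣ p.2 - δ) →
      (((T b ×ˢ T a).filter P).card : ℂ) = (q : ℂ) ^ (a + b) * nearDensity (q : ℂ)⁻¹ b k d := by
  classical
  induction j with
  | zero =>
    intro k hk hkb P _ hP
    obtain rfl : k = b := by omega
    rw [card_filter_product_eq_mul' (T k) (T a) P (fun z => π ^ k ∣ z - e)
      (fun g => π ^ max 1 (d - k) ∣ g - δ), Nat.cast_mul,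
      cast_card_filter_dvd_sub hπ hT hq le_rfl e _ fun t _ => Iff.rfl,
      cast_card_filter_dvd_sub hπ hT hq (by omega) δ _ fun t _ => Iff.rfl, nearDensity]
    · rw [show min (d - 1) k - k = 0 by omega, show max d (k + 1) = k + max 1 (d - k) by omega]
      push_cast; ring
    · intro z _ g _
      rw [hP, pow_max_dvd_iff, pow_one]
      refine and_congr_right fun hz => and_congr_right fun hg => ?_
      rw [and_iff_right_iff_imp]
      intro h
      refine (pow_dvd_pow π (show d ≤ d - k + k by omega)).trans ?_
      rw [pow_add]
      exact mul_dvd_mul h hz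
  | succ j ih =>
    intro k hk hkb P _ hP
    have hs : ((T b ×ˢ T a).filter P).card =
        ((T b ×ˢ T a).filter fun p => P p ∧ π ^ (k + 1) ∣ p.1 - e).card +
        ((T b ×ˢ T a).filter fun p => P p ∧ ¬ π ^ (k + 1) ∣ p.1 - e).card := by
      rw [← Finset.filter_filter, ← Finset.filter_filter,
        Finset.card_filter_add_card_filter_not]
    have hz : ((T b).filter fun z => π ^ k ∣ z - e).card =
        ((T b).filter fun z => π ^ (k + 1) ∣ z - e).card +
        ((T b).filter fun z => π ^ k ∣ z - e ∧ ¬ π ^ (k + 1) ∣ z - e).card := by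
      rw [← Finset.filter_filter, ← Finset.card_filter_add_card_filter_not
        (s := (T b).filter fun z => π ^ k ∣ z - e) (fun z => π ^ (k + 1) ∣ z - e),
        Finset.filter_filter]
      congr 2
      refine Finset.filter_congr fun z _ => ?_
      exact and_iff_right_of_imp fun h => (pow_dvd_pow π (Nat.le_succ k)).trans h
    have hz' := congrArg (Nat.cast : ℕ → ℂ) hz
    rw [Nat.cast_add, cast_card_filter_dvd_sub hπ hT hq (by omega) e _ fun t _ => Iff.rfl,
      cast_card_filter_dvd_sub hπ hT hq (by omega) e _ fun t _ => Iff.rfl] at hz'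
    rw [hs, Nat.cast_add, ih (k + 1) (by omega) (by omega),
      card_filter_product_eq_mul' (T b) (T a) _
      (fun z => π ^ k ∣ z - e ∧ ¬ π ^ (k + 1) ∣ z - e)
      (fun g => π ^ max 1 (d - k) ∣ g - δ), Nat.cast_mul,
      cast_card_filter_dvd_sub hπ hT hq (by omega) δ _ fun t _ => Iff.rfl,
      nearDensity_step _ (by omega : k < b)]
    · linear_combination (-(q : ℂ) ^ a * (q : ℂ)⁻¹ ^ max 1 (d - k)) * hz'
    · intro z _ g _
      rw [hP, pow_max_dvd_iff, pow_one]
      dsimp only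
      rw [and_right_comm]
      refine and_congr_right fun ⟨⟨w, hw⟩, hz2⟩ => and_congr_right fun hg => ?_
      have hwu : IsUnit w := by
        rw [← not_dvd_iff_isUnit hπ]
        rintro ⟨s, rfl⟩
        exact hz2 ⟨s, by rw [hw, pow_succ]; ring⟩
      have h1 : π ^ d ∣ (g - δ) * (z - e) ↔ π ^ (d - k) ∣ g - δ := by
        rw [hw, mul_left_comm, pow_dvd_pow_mul_iff_pow_sub_dvd hπ.ne_zero, hwu.dvd_mul_right]
      rw [h1, and_iff_left_iff_imp]
      exact fun h => (pow_dvd_pow π (by omega)).trans h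
    · rintro ⟨z, g⟩
      rw [hP, and_right_comm, and_congr_left_iff]
      rintro -
      refine and_iff_right_of_imp fun h => (pow_dvd_pow π (Nat.le_succ k)).trans h

variable {a b c : ℕ}

/-- Here δ is 0 or -1, a root of g(1 + g) = (g - δ)(g + δ + 1), and near δ the second factor is a
unit. -/
theorem card_near_pairs_root (hπ : Irreducible π) (hT : IsResidueSystem π q T) (hq : 1 < q)
    (ha : 1 ≤ a) (hb : 1 ≤ b) {δ : O} (hδ : δ * δ + δ = 0) (e : O)
    (P : O × O → Prop) [DecidablePred P]
    (hP : ∀ p, P p ↔ (π ∣ p.1 - e ∧ π ^ b ∣ π ^ c * (p.1 - e)) ∧ π ∣ p.2 - δ ∧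
        π ^ a ∣ π ^ c * (p.2 * (1 + p.2) * (p.1 - e)) ∧
        π ^ a ∣ π ^ (b + c) * (p.2 * (1 + p.2))) :
    (((T b ×ˢ T a).filter P).card : ℂ) =
      (q : ℂ) ^ (a + b) * nearDensity (q : ℂ)⁻¹ b (max 1 (b - c)) (a - c) := by
  refine card_near_pairs hπ hT hq ha (Nat.sub_le _ _) e δ (b - max 1 (b - c)) _ (by omega)
    (by omega) P ?_
  rintro ⟨z, g⟩
  rw [hP, pow_max_dvd_iff, pow_one]
  simp only [pow_dvd_pow_mul_iff_pow_sub_dvd hπ.ne_zero]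
  refine and_congr_right fun _ => and_congr_right fun hg => ?_
  have h2 : IsUnit (1 + 2 * δ) :=
    IsUnit.of_mul_eq_one (1 + 2 * δ) (by linear_combination 4 * hδ)
  have hu : IsUnit (g + δ + 1) := isUnit_of_dvd_sub hπ h2 (by convert hg using 1; ring)
  have e1 : g * (1 + g) = (g - δ) * (g + δ + 1) := by linear_combination hδ
  rw [e1, mul_right_comm, hu.dvd_mul_right, hu.dvd_mul_right, Nat.sub_sub, Nat.add_comm c b]

open Classical in
/-- The normalised number of pairs `(z, g)` with `v(z) ≥ k`, `v(z) ≥ d` and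
`g` generic, provided that `d ≤ b`. -/
noncomputable def genericDensity (v : ℂ) (b k d : ℕ) : ℂ :=
  if d ≤ b then (1 - 2 * v) * v ^ max k d else 0

/-- Now g(1 + g) is a unit, so the last condition reads a ≤ b + c and the others concern z only. -/
theorem card_near_pairs_generic (hπ : Irreducible π) (hT : IsResidueSystem π q T) (hq : 1 < q)
    (ha : 1 ≤ a) (hb : 1 ≤ b) (e : O)
    (P : O × O → Prop) [DecidablePred P]
    (hP : ∀ p, P p ↔ (π ∣ p.1 - e ∧ π ^ b ∣ π ^ c * (p.1 - e)) ∧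
      (¬ π ∣ p.2 - 0 ∧ ¬ π ∣ p.2 - (-1)) ∧
        π ^ a ∣ π ^ c * (p.2 * (1 + p.2) * (p.1 - e)) ∧
        π ^ a ∣ π ^ (b + c) * (p.2 * (1 + p.2))) :
    (((T b ×ˢ T a).filter P).card : ℂ) =
      (q : ℂ) ^ (a + b) * genericDensity (q : ℂ)⁻¹ b (max 1 (b - c)) (a - c) := by
  classical
  have hu : ∀ g : O, (¬ π ∣ g - 0 ∧ ¬ π ∣ g - (-1)) → IsUnit (g * (1 + g)) := by
    rintro g ⟨h1, h2⟩
    rw [not_dvd_iff_isUnit hπ] at h1 h2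
    convert h1.mul h2 using 1; ring
  have hp : ∀ {n : ℕ}, π ^ n ∣ 1 ↔ n = 0 := by
    intro n
    rw [← pow_zero π, pow_dvd_pow_iff_le hπ, Nat.le_zero]
  rw [genericDensity]
  split_ifs with h
  · rw [card_filter_product_eq_mul' (T b) (T a) P
      (fun z => π ^ max (max 1 (b - c)) (a - c) ∣ z - e)
      (fun g => ¬ π ∣ g - 0 ∧ ¬ π ∣ g - (-1)), Nat.cast_mul,
      cast_card_filter_dvd_sub hπ hT hq (by omega) e _ fun t _ => Iff.rfl,
      cast_card_filter_not_dvd hπ hT hq ha (u := 0) (v := -1) (by simp) _ fun t => Iff.rfl]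
    · ring
    · intro z _ g _
      rw [hP, pow_max_dvd_iff, pow_max_dvd_iff, pow_one]
      dsimp only
      by_cases hg : ¬ π ∣ g - 0 ∧ ¬ π ∣ g - (-1)
      · simp only [pow_dvd_pow_mul_iff_pow_sub_dvd hπ.ne_zero, (hu g hg).dvd_mul_left]
        have : π ^ (a - (b + c)) ∣ g * (1 + g) := by
          rw [show a - (b + c) = 0 by omega, pow_zero]; exact one_dvd _
        tauto
      · tauto
  · rw [mul_zero, Nat.cast_eq_zero, Finset.card_eq_zero, Finset.filter_eq_empty_iff]
    rintro ⟨z, g⟩ _ hc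
    obtain ⟨-, hg, -, hg2⟩ := (hP _).1 hc
    rw [(hu g hg).dvd_mul_right, pow_dvd_pow_iff_le hπ] at hg2
    omega

theorem boxCount_near_near_dvd (hπ : Irreducible π) (hT : IsResidueSystem π q T) (hq : 1 < q)
    (ha : 1 ≤ a) (hb : 1 ≤ b) (hc : c < a + b) {e : O} (he : e * e = e) :
    (boxCount π T c a b (fun y => π ∣ y - e) (fun z => π ∣ z - e) (fun g => π ∣ g) : ℂ) =
      (q : ℂ) ^ c * (q : ℂ) ^ (a + b) * nearDensity (q : ℂ)⁻¹ b (max 1 (b - c)) (a - c) := by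
  classical
  rw [boxCount_near_near hπ hT hc he _ _ fun _ => Iff.rfl, Nat.cast_mul,
    card_near_pairs_root hπ hT hq ha hb (δ := 0) (by simp) e _ fun p => by rw [sub_zero],
    Nat.cast_pow, mul_assoc]

/-- Split g into the classes of 0 and of -1, which contribute equally, and the rest. -/
theorem boxCount_near_near_true (hπ : Irreducible π) (hT : IsResidueSystem π q T) (hq : 1 < q)
    (ha : 1 ≤ a) (hb : 1 ≤ b) (hc : c < a + b) {e : O} (he : e * e = e) :
    (boxCount π T c a b (fun y => π ∣ y - e) (fun z => π ∣ z - e) (fun _ => True) : ℂ) =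
      (q : ℂ) ^ c * (q : ℂ) ^ (a + b) * (2 * nearDensity (q : ℂ)⁻¹ b (max 1 (b - c)) (a - c)
        + genericDensity (q : ℂ)⁻¹ b (max 1 (b - c)) (a - c)) := by
  classical
  obtain ⟨A, hA⟩ : ∃ A : O × O → Prop, ∀ p, A p ↔ π ∣ p.1 - e ∧ π ^ b ∣ π ^ c * (p.1 - e) :=
    ⟨_, fun _ => Iff.rfl⟩
  obtain ⟨B, hB⟩ : ∃ B : O × O → Prop, ∀ p, B p ↔ π ^ a ∣ π ^ c * (p.2 * (1 + p.2) * (p.1 - e)) ∧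
      π ^ a ∣ π ^ (b + c) * (p.2 * (1 + p.2)) := ⟨_, fun _ => Iff.rfl⟩
  have hs : ((T b ×ˢ T a).filter fun p => A p ∧ B p).card =
      ((T b ×ˢ T a).filter fun p => A p ∧ π ∣ p.2 - 0 ∧ B p).card +
      ((T b ×ˢ T a).filter fun p => A p ∧ π ∣ p.2 - (-1) ∧ B p).card +
      ((T b ×ˢ T a).filter fun p => A p ∧ (¬ π ∣ p.2 - 0 ∧ ¬ π ∣ p.2 - (-1)) ∧ B p).card := by
    simp only [Finset.card_filter, ← Finset.sum_add_distrib]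
    refine Finset.sum_congr rfl fun p _ => ?_
    have : ¬ (π ∣ p.2 - 0 ∧ π ∣ p.2 - (-1)) := by
      rintro ⟨h0, h1⟩
      refine hπ.not_isUnit (isUnit_of_dvd_one ?_)
      convert dvd_sub h1 h0 using 1; ring
    split_ifs <;> first | rfl | (exfalso; tauto)
  rw [boxCount_near_near hπ hT hc he _ (fun p => A p ∧ B p) fun p => by rw [hA, hB, true_and], hs,
    Nat.cast_mul, Nat.cast_add, Nat.cast_add,
    card_near_pairs_root (c := c) hπ hT hq ha hb (δ := 0) (by simp) e _
      fun p => by rw [hA, hB],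
    card_near_pairs_root (c := c) hπ hT hq ha hb (δ := -1) (by simp) e _
      fun p => by rw [hA, hB],
    card_near_pairs_generic (c := c) hπ hT hq ha hb e _ fun p => by rw [hA, hB], Nat.cast_pow]
  ring

theorem boxCount_near_compl_dvd (hπ : Irreducible π) (hT : IsResidueSystem π q T) (hq : 1 < q)
    (ha : 1 ≤ a) (hb : 1 ≤ b) (hc : c < a + b) {e e' : O} (he : e * e = e) (hee : e + e' = 1) :
    (boxCount π T c a b (fun y => π ∣ y - e) (fun z => π ∣ z - e') (fun g => π ∣ g) : ℂ) =
      (q : ℂ) ^ c * (q : ℂ) ^ (a + b) * ((q : ℂ)⁻¹ ^ max 1 (b - c) * (q : ℂ)⁻¹ ^ max 1 (a - c)) := by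
  classical
  rw [boxCount_near_compl hπ hT hc he hee _ _ fun _ => Iff.rfl, card_filter_product_eq_mul' (T b) (T a) _
    (fun z => π ^ max 1 (b - c) ∣ z - e') (fun g => π ^ max 1 (a - c) ∣ g - 0), Nat.cast_mul,
    Nat.cast_mul, cast_card_filter_dvd_sub hπ hT hq (by omega) e' _ fun t _ => Iff.rfl,
    cast_card_filter_dvd_sub hπ hT hq (by omega) 0 _ fun t _ => Iff.rfl, Nat.cast_pow]
  · ring
  · intro z _ g _
    simp only [pow_max_dvd_iff, pow_one, pow_dvd_pow_mul_iff_pow_sub_dvd hπ.ne_zero, sub_zero]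

theorem boxCount_near_compl_true (hπ : Irreducible π) (hT : IsResidueSystem π q T) (hq : 1 < q)
    (hb : 1 ≤ b) (hc : c < a + b) {e e' : O} (he : e * e = e) (hee : e + e' = 1) :
    (boxCount π T c a b (fun y => π ∣ y - e) (fun z => π ∣ z - e') (fun _ => True) : ℂ) =
      (q : ℂ) ^ c * (q : ℂ) ^ (a + b) * ((q : ℂ)⁻¹ ^ max 1 (b - c) * (q : ℂ)⁻¹ ^ (a - c)) := by
  classical
  rw [boxCount_near_compl hπ hT hc he hee _ _ fun _ => Iff.rfl, card_filter_product_eq_mul' (T b) (T a) _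
    (fun z => π ^ max 1 (b - c) ∣ z - e') (fun g => π ^ (a - c) ∣ g - 0), Nat.cast_mul,
    Nat.cast_mul, cast_card_filter_dvd_sub hπ hT hq (by omega) e' _ fun t _ => Iff.rfl,
    cast_card_filter_dvd_sub hπ hT hq (by omega) 0 _ fun t _ => Iff.rfl, Nat.cast_pow]
  · ring
  · intro z _ g _
    simp only [pow_max_dvd_iff, pow_one, pow_dvd_pow_mul_iff_pow_sub_dvd hπ.ne_zero, sub_zero,
      true_and]

theorem cast_boxCount_near_generic (hπ : Irreducible π) (hT : IsResidueSystem π q T) (hq : 1 < q)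
    (ha : 1 ≤ a) (hb : 1 ≤ b) (hc : c < a + b)
    {e : O} (he : e = 0 ∨ e = 1) (Pg : O → Prop) (hPg : ∀ g, π ∣ g → Pg g) :
    (boxCount π T c a b (fun y => π ∣ y - e) (IsGeneric π) Pg : ℂ) =
      (q : ℂ) ^ c * (q : ℂ) ^ (a + b) *
        if b ≤ c then (1 - 2 * (q : ℂ)⁻¹) * (q : ℂ)⁻¹ ^ max 1 (a - c) else 0 := by
  classical
  rw [boxCount_near_generic hπ hT hc he Pg hPg _ fun _ => Iff.rfl]
  split_ifs with h
  · rw [card_filter_product_eq_mul' (T b) (T a) _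
      (IsGeneric π) (fun g => π ^ max 1 (a - c) ∣ g - 0), Nat.cast_mul,
      Nat.cast_mul,
      cast_card_filter_not_dvd hπ hT hq hb (u := 0) (v := 1) (by simp) (IsGeneric π) fun t => Iff.rfl,
      cast_card_filter_dvd_sub hπ hT hq (by omega) 0 _ fun t _ => Iff.rfl, Nat.cast_pow]
    · ring
    · intro z _ g _
      simp only [pow_max_dvd_iff, pow_one, pow_dvd_pow_mul_iff_pow_sub_dvd hπ.ne_zero, sub_zero,
        h, and_true]
  · simp [h]

theorem cast_boxCount_generic_generic (hπ : Irreducible π) (hT : IsResidueSystem π q T)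
    (hq : 1 < q) (ha : 1 ≤ a) (hb : 1 ≤ b) (hc : c < a + b) :
    (boxCount π T c a b (IsGeneric π) (IsGeneric π) (fun _ => True) : ℂ) =
      (q : ℂ) ^ c * (q : ℂ) ^ (a + b) * if b ≤ c then (1 - 2 * (q : ℂ)⁻¹) *
        (if a ≤ c then 1 - 2 * (q : ℂ)⁻¹ else (q : ℂ)⁻¹ ^ (a - c)) else 0 := by
  classical
  split_ifs with h h'
  · rw [boxCount_generic_generic hπ hT hc h, card_filter_product_eq_mul' (T (a + b)) (T b) _
      (IsGeneric π) (IsGeneric π), Nat.cast_mul,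
      Nat.cast_mul,
      cast_card_filter_not_dvd hπ hT hq hb (u := 0) (v := 1) (by simp) (IsGeneric π) fun t => Iff.rfl,
      cast_card_filter_not_dvd hπ hT hq (by omega) (u := 0) (v := 1) (by simp) (IsGeneric π) fun t => Iff.rfl,
      Nat.cast_pow]
    · obtain ⟨m, rfl⟩ := Nat.exists_eq_add_of_le h
      rw [Nat.add_sub_cancel_left]; ring
    · intro y _ z _
      rw [show a - c = 0 by omega, pow_zero]
      simp [and_comm]
  · rw [boxCount_generic_generic hπ hT hc h, card_filter_product_eq_mul (T (a + b)) (T b) _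
      (IsGeneric π) (q ^ (a + b - (a - c))) (fun z y => π ^ (a - c) ∣ y - z),
      Nat.cast_mul, Nat.cast_mul,
      cast_card_filter_not_dvd hπ hT hq hb (u := 0) (v := 1) (by simp) (IsGeneric π) fun t => Iff.rfl,
      Nat.cast_pow]
    · have hq0 : (q : ℂ) ≠ 0 := by exact_mod_cast (by omega : q ≠ 0)
      obtain ⟨m, rfl⟩ := Nat.exists_eq_add_of_le h
      obtain ⟨d, rfl⟩ := Nat.exists_eq_add_of_lt (not_le.1 h')
      rw [Nat.add_sub_cancel_left, show b + m + d + 1 - (b + m) = d + 1 by omega,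
        show b + m + d + 1 + b - (d + 1) = b + m + b by omega]
      have : (q : ℂ) ^ (d + 1) * (q : ℂ)⁻¹ ^ (d + 1) = 1 := by
        rw [← mul_pow, mul_inv_cancel₀ hq0, one_pow]
      push_cast
      linear_combination (-(q : ℂ) ^ (b + m + b + m + b) * (1 - 2 * (q : ℂ)⁻¹)) * this
    · intro y _ z _
      dsimp only
      -- As a > c, y ≡ z modulo π, so y is generic as soon as z is.
      refine and_congr_right fun hz => and_iff_right_of_imp fun h2 => ?_
      have h3 : π ∣ y - z := (dvd_pow_self π (by omega)).trans h2
      refine ⟨fun h4 => hz.1 ?_, fun h4 => hz.2 ?_⟩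
      · convert dvd_sub h4 h3 using 1; ring
      · convert dvd_sub h4 h3 using 1; ring
    · intro z _ _
      exact hT.card_filter_dvd_sub hπ.ne_zero (by omega) z _ fun t _ => Iff.rfl
  · rw [boxCount_generic_generic_of_lt hπ T (not_le.1 h)]; simp

end

/-! ### The total count of subalgebras -/

/-- The sum over the six Bruhat cells, indexed by the inversions of the permutation. -/
theorem sum_perm_fin_three {M : Type*} [AddCommMonoid M] (F : Bool × Bool × Bool → M) :
    ∑ σ : Equiv.Perm (Fin 3),
      F (decide (σ 1 < σ 0), decide (σ 2 < σ 0), decide (σ 2 < σ 1)) =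
    F (false, false, false) + (F (false, false, true) + (F (true, false, false) +
      (F (false, true, true) + (F (true, true, false) + F (true, true, true))))) := by
  have h : (Finset.univ : Finset (Equiv.Perm (Fin 3))).val.map
      (fun σ => (decide (σ 1 < σ 0), decide (σ 2 < σ 0), decide (σ 2 < σ 1))) =
      {(false, false, false), (false, false, true), (true, false, false),
      (false, true, true), (true, true, false), (true, true, true)} := by decide
  rw [Finset.sum, ← Function.comp_def F, ← Multiset.map_map, h]
  simp

/-- The condition `π ∣ y`, imposed if `s` is `true`. -/
def restrictDvd {O : Type*} [CommRing O] (π : O) (s : Bool) (y : O) : Prop := s = true → π ∣ y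

/-- The normalised number of multiplicatively closed lattices. -/
noncomputable def latticeDensity (v : ℂ) (c a b : ℕ) : ℂ :=
  if a + b ≤ c then (1 + v) * (1 + v + v ^ 2) else
    v ^ (a + b - c) * (4 * (3 * nearDensity v b (max 1 (b - c)) (a - c)
      + genericDensity v b (max 1 (b - c)) (a - c))
      + 3 * v ^ max 1 (b - c) * (v ^ (a - c) + v ^ max 1 (a - c))
      + if b ≤ c then 5 * ((1 - 2 * v) * v ^ max 1 (a - c))
          + (1 - 2 * v) * (if a ≤ c then 1 - 2 * v else v ^ (a - c)) else 0)

section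

variable {O : Type*} [CommRing O] [IsDomain O] [IsDiscreteValuationRing O] {π : O} {q : ℕ}
  {T : ℕ → Finset O} {a b c : ℕ}

theorem subalgebraCount_eq_sum_boxCount (hπ : Irreducible π) (hT : IsResidueSystem π q T)
    (r : ({1, 2} : Finset ℕ) → ℕ+) (ha : (r ⟨1, by simp⟩ : ℕ) = a)
    (hb : (r ⟨2, by simp⟩ : ℕ) = b) :
    subalgebraCount π 3 {1, 2} c r =
      boxCount π T c a b (restrictDvd π false) (restrictDvd π false) (restrictDvd π false) +
      (boxCount π T c a b (restrictDvd π false) (restrictDvd π false) (restrictDvd π true) +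
      (boxCount π T c a b (restrictDvd π true) (restrictDvd π false) (restrictDvd π false) +
      (boxCount π T c a b (restrictDvd π false) (restrictDvd π true) (restrictDvd π true) +
      (boxCount π T c a b (restrictDvd π true) (restrictDvd π true) (restrictDvd π false) +
      boxCount π T c a b (restrictDvd π true) (restrictDvd π true) (restrictDvd π true))))) := by
  classical
  rw [subalgebraCount_eq_sum hπ hT c r ha hb]
  refine Eq.trans (Finset.sum_congr rfl fun σ _ => ?_) (sum_perm_fin_three fun s =>
    boxCount π T c a b (restrictDvd π s.1) (restrictDvd π s.2.1) (restrictDvd π s.2.2))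
  unfold boxCount
  congr 1
  refine Finset.filter_congr fun p _ => ?_
  simp [IsCellParam, restrictDvd]

theorem restrictDvd_false {O : Type*} [CommRing O] {π : O} : restrictDvd π false = fun _ => True := by
  funext y; simp [restrictDvd]

theorem restrictDvd_true {O : Type*} [CommRing O] {π : O} : restrictDvd π true = fun y => π ∣ y := by
  funext y; simp [restrictDvd]

/-- All closure conditions are void, so only the cell normalisations count, each costing a factor v.
-/
theorem cast_boxCount_of_le {O : Type*} [CommRing O] [IsDomain O] {π : O} {q : ℕ}
    {T : ℕ → Finset O} {a b c : ℕ} (hπ : Irreducible π) (hT : IsResidueSystem π q T) (hq : 1 < q)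
    (ha : 1 ≤ a) (hb : 1 ≤ b) (hc : a + b ≤ c) (s t u : Bool) :
    (boxCount π T c a b (restrictDvd π s) (restrictDvd π t) (restrictDvd π u) : ℂ) =
      ((q : ℂ) ^ (a + b)) ^ 2 * (((q : ℂ)⁻¹ ^ s.toNat) * ((q : ℂ)⁻¹ ^ t.toNat)
        * ((q : ℂ)⁻¹ ^ u.toNat)) := by
  classical
  have h : ∀ (s : Bool) (y : O), restrictDvd π s y ↔ π ^ s.toNat ∣ y - 0 := by
    rintro (_ | _) y <;> simp [restrictDvd]
  have hs : ∀ s : Bool, s.toNat ≤ 1 := by decide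
  have h1 := hs s
  have h2 := hs t
  have h3 := hs u
  have hM : ∀ y z g, IsMulClosedParam π c a b y z g := fun y z g =>
    ⟨dvd_mul_of_dvd_left (pow_dvd_pow _ hc) _, dvd_mul_of_dvd_left (pow_dvd_pow _ (by omega)) _,
      dvd_mul_of_dvd_left (pow_dvd_pow _ (by omega)) _,
      dvd_mul_of_dvd_left (pow_dvd_pow _ (by omega)) _⟩
  rw [boxCount, card_filter_product_eq_mul' (T (a + b)) (T b ×ˢ T a) _ (restrictDvd π s)
    (fun p => restrictDvd π t p.1 ∧ restrictDvd π u p.2),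
    card_filter_product_eq_mul' (T b) (T a) _ (restrictDvd π t) (restrictDvd π u),
    Nat.cast_mul, Nat.cast_mul,
    cast_card_filter_dvd_sub hπ hT hq (by omega) 0 _ fun t _ => h _ t,
    cast_card_filter_dvd_sub hπ hT hq (by omega) 0 _ fun t _ => h _ t,
    cast_card_filter_dvd_sub hπ hT hq (by omega) 0 _ fun t _ => h _ t]
  · ring
  · intros; rfl
  · intros; simp [hM]

/-- The coefficients record how often each type of box occurs in the six cells. Boxes with y, z near
the same idempotent occur four times with g free and four times with π ∣ g; those with y, z near
different idempotents three times each; y near and z generic 3 + 2 times; both generic once. -/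
theorem cast_subalgebraCount (hπ : Irreducible π) (hT : IsResidueSystem π q T) (hq : 1 < q)
    (r : ({1, 2} : Finset ℕ) → ℕ+) (ha : (r ⟨1, by simp⟩ : ℕ) = a)
    (hb : (r ⟨2, by simp⟩ : ℕ) = b) :
    (subalgebraCount π 3 {1, 2} c r : ℂ) =
      ((q : ℂ) ^ (a + b)) ^ 2 * latticeDensity (q : ℂ)⁻¹ c a b := by
  have ha1 : 1 ≤ a := ha ▸ (r ⟨1, by simp⟩).pos
  have hb1 : 1 ≤ b := hb ▸ (r ⟨2, by simp⟩).pos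
  rw [subalgebraCount_eq_sum_boxCount hπ hT r ha hb]
  unfold latticeDensity
  by_cases h : a + b ≤ c
  · rw [if_pos h]
    simp only [Nat.cast_add]
    simp only [cast_boxCount_of_le hπ hT hq ha1 hb1 h]
    simp only [Bool.toNat_true, Bool.toNat_false]
    ring
  · rw [if_neg h]
    have hc := not_le.1 h
    -- This turns the q^c Hensel lifts into the prefactor v^(a+b-c) of the density.
    have hqc : (q : ℂ) ^ c = (q : ℂ) ^ (a + b) * (q : ℂ)⁻¹ ^ (a + b - c) := by
      have hq0 : (q : ℂ) ≠ 0 := by exact_mod_cast (by omega : q ≠ 0)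
      obtain ⟨m, hm⟩ := Nat.exists_eq_add_of_lt hc
      rw [hm, show c + m + 1 - c = m + 1 by omega, show c + m + 1 = c + (m + 1) by omega, pow_add,
        mul_assoc, ← mul_pow, mul_inv_cancel₀ hq0, one_pow, mul_one]
    have e00 : (0 : O) * 0 = 0 := by simp
    have e11 : (1 : O) * 1 = 1 := by simp
    have e01 : (0 : O) + 1 = 1 := by simp
    have e10 : (1 : O) + 0 = 1 := by simp
    have hT1 : ∀ g : O, π ∣ g → (fun _ : O => True) g := fun _ _ => trivial
    have hT2 : ∀ g : O, π ∣ g → (fun g : O => π ∣ g) g := fun _ h => h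
    have n0T := boxCount_near_near_true hπ hT hq ha1 hb1 hc e00
    have n1T := boxCount_near_near_true hπ hT hq ha1 hb1 hc e11
    have n0d := boxCount_near_near_dvd hπ hT hq ha1 hb1 hc e00
    have n1d := boxCount_near_near_dvd hπ hT hq ha1 hb1 hc e11
    have c0T := boxCount_near_compl_true hπ hT hq hb1 hc e00 e01
    have c1T := boxCount_near_compl_true hπ hT hq hb1 hc e11 e10
    have c0d := boxCount_near_compl_dvd hπ hT hq ha1 hb1 hc e00 e01
    have c1d := boxCount_near_compl_dvd hπ hT hq ha1 hb1 hc e11 e10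
    have g0T := cast_boxCount_near_generic hπ hT hq ha1 hb1 hc (Or.inl rfl) _ hT1
    have g1T := cast_boxCount_near_generic hπ hT hq ha1 hb1 hc (Or.inr rfl) _ hT1
    have g0d := cast_boxCount_near_generic hπ hT hq ha1 hb1 hc (Or.inl rfl) _ hT2
    have g1d := cast_boxCount_near_generic hπ hT hq ha1 hb1 hc (Or.inr rfl) _ hT2
    have gg := cast_boxCount_generic_generic hπ hT hq ha1 hb1 hc
    have hr : restrictDvd π true = fun y : O => π ∣ y - 0 := by
      rw [restrictDvd_true]; simp
    have sFF : ∀ Pg, boxCount π T c a b (restrictDvd π false) (restrictDvd π false) Pg =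
        boxCount π T c a b (fun y => π ∣ y - 0) (fun y => π ∣ y - 0) Pg
        + boxCount π T c a b (fun y => π ∣ y - 0) (fun y => π ∣ y - 1) Pg
        + boxCount π T c a b (fun y => π ∣ y - 0) (IsGeneric π) Pg
        + (boxCount π T c a b (fun y => π ∣ y - 1) (fun y => π ∣ y - 0) Pg
        + boxCount π T c a b (fun y => π ∣ y - 1) (fun y => π ∣ y - 1) Pg
        + boxCount π T c a b (fun y => π ∣ y - 1) (IsGeneric π) Pg)
        + boxCount π T c a b (IsGeneric π) (IsGeneric π) Pg := fun Pg => by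
      rw [restrictDvd_false, boxCount_split_left hπ, boxCount_split_mid hπ, boxCount_split_mid hπ,
        boxCount_split_mid hπ, boxCount_generic_near hπ T hc e00,
        boxCount_generic_near hπ T hc e11, zero_add, zero_add]
    have sTF : ∀ Pg, boxCount π T c a b (restrictDvd π true) (restrictDvd π false) Pg =
        boxCount π T c a b (fun y => π ∣ y - 0) (fun y => π ∣ y - 0) Pg
        + boxCount π T c a b (fun y => π ∣ y - 0) (fun y => π ∣ y - 1) Pg
        + boxCount π T c a b (fun y => π ∣ y - 0) (IsGeneric π) Pg := fun Pg => by
      rw [restrictDvd_false, boxCount_split_mid hπ, hr]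
    have sFT : ∀ Pg, boxCount π T c a b (restrictDvd π false) (restrictDvd π true) Pg =
        boxCount π T c a b (fun y => π ∣ y - 0) (fun y => π ∣ y - 0) Pg
        + boxCount π T c a b (fun y => π ∣ y - 1) (fun y => π ∣ y - 0) Pg := fun Pg => by
      rw [restrictDvd_false, boxCount_split_left hπ, hr, boxCount_generic_near hπ T hc e00,
        add_zero]
    have sTT : ∀ Pg, boxCount π T c a b (restrictDvd π true) (restrictDvd π true) Pg =
        boxCount π T c a b (fun y => π ∣ y - 0) (fun y => π ∣ y - 0) Pg := fun Pg => by rw [hr]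
    rw [sFF, sFF, sTF, sFT, sTT, sTT, restrictDvd_true, restrictDvd_false,
      boxCount_generic_generic_dvd hπ T hc]
    push_cast
    rw [n0T, n1T, n0d, n1d, c0T, c1T, c0d, c1d, g0T, g1T, g0d, g1d, gg, hqc]
    split_ifs <;> ring

end

/-! ### Geometric series over simplicial cones -/

/-- Transfers a sum over free coordinates in ℕ³ to the lattice points of a cone, extended by zero;
`inv` reads off the coordinates along the generators. -/
theorem hasSum_of_cone {f : ℕ × ℕ × ℕ → ℂ} {S : ℂ} (cond : ℕ × ℕ × ℕ → Prop) [DecidablePred cond]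
    (g inv : ℕ × ℕ × ℕ → ℕ × ℕ × ℕ) (h1 : ∀ y, cond (g y)) (h2 : ∀ y, inv (g y) = y)
    (h3 : ∀ x, cond x → g (inv x) = x) (h : HasSum (fun y => f (g y)) S) :
    HasSum (fun x => if cond x then f x else 0) S := by
  have hg : Function.Injective g := Function.LeftInverse.injective h2
  refine (hg.hasSum_iff fun x hx => if_neg fun hc => hx ⟨_, h3 x hc⟩).1 ?_
  refine h.congr_fun ?_
  intro y
  simp [h1]

theorem hasSum_linear_geometric (α β : ℂ) {p : ℂ} (hp : ‖p‖ < 1) :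
    Summable (fun n : ℕ => ‖(α + β * n) * p ^ n‖) ∧
    HasSum (fun n : ℕ => (α + β * n) * p ^ n) (α * (1 - p)⁻¹ + β * (p / (1 - p) ^ 2)) := by
  constructor
  · have h1 := (summable_norm_geometric_of_norm_lt_one hp).mul_left ‖α‖
    have h2 := (summable_norm_pow_mul_geometric_of_norm_lt_one 1 hp).mul_left ‖β‖
    refine (h1.add h2).of_nonneg_of_le (fun _ => norm_nonneg _) fun n => ?_
    rw [← norm_mul, ← norm_mul]
    refine le_trans (le_of_eq (congrArg _ ?_)) (norm_add_le _ _)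
    ring
  · have h1 := (hasSum_geometric_of_norm_lt_one hp).mul_left α
    have h2 := (hasSum_coe_mul_geometric_of_norm_lt_one hp).mul_left β
    refine (h1.add h2).congr_fun fun n => ?_
    ring

theorem hasSum_mul_of_summable_norm {ι κ : Type*} {f : ι → ℂ} {g : κ → ℂ} {F G : ℂ}
    (hf : Summable fun i => ‖f i‖) (hg : Summable fun j => ‖g j‖) (hF : HasSum f F)
    (hG : HasSum g G) : HasSum (fun y : ι × κ => f y.1 * g y.2) (F * G) :=
  hF.mul hG (summable_mul_of_summable_norm hf hg)

theorem hasSum_mul_mul_of_summable_norm {f g h : ℕ → ℂ} {F G H : ℂ}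
    (hf : Summable fun n => ‖f n‖) (hg : Summable fun n => ‖g n‖) (hh : Summable fun n => ‖h n‖)
    (hF : HasSum f F) (hG : HasSum g G) (hH : HasSum h H) :
    HasSum (fun y : ℕ × ℕ × ℕ => f y.1 * (g y.2.1 * h y.2.2)) (F * (G * H)) := by
  have h1 : Summable fun y : ℕ × ℕ => ‖g y.1 * h y.2‖ := by
    simpa only [norm_mul] using hg.mul_of_nonneg hh (fun _ => norm_nonneg _) fun _ => norm_nonneg _
  exact hasSum_mul_of_summable_norm (g := fun y : ℕ × ℕ => g y.1 * h y.2) (G := G * H) hf h1 hF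
    (hasSum_mul_of_summable_norm hg hh hG hH)

theorem hasSum_cone_geometric (α β : ℂ) {p r s : ℂ} (hp : ‖p‖ < 1) (hr : ‖r‖ < 1) (hs : ‖s‖ < 1) :
    HasSum (fun y : ℕ × ℕ × ℕ => ((α + β * y.1) * p ^ y.1) * (r ^ y.2.1 * s ^ y.2.2))
      ((α * (1 - p)⁻¹ + β * (p / (1 - p) ^ 2)) * ((1 - r)⁻¹ * (1 - s)⁻¹)) :=
  hasSum_mul_mul_of_summable_norm (f := fun n : ℕ => (α + β * n) * p ^ n)
    (g := fun n : ℕ => r ^ n) (h := fun n : ℕ => s ^ n)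
    (hasSum_linear_geometric α β hp).1 (summable_norm_geometric_of_norm_lt_one hr)
    (summable_norm_geometric_of_norm_lt_one hs) (hasSum_linear_geometric α β hp).2
    (hasSum_geometric_of_norm_lt_one hr) (hasSum_geometric_of_norm_lt_one hs)

/-! ### The density on each cone -/

/-- The part of `latticeDensity` in the region `c < a`, `c < b` that is split off. -/
noncomputable def cornerDensity (v : ℂ) (c a b : ℕ) : ℂ :=
  if c < a ∧ c < b then 6 * v ^ ((a + b - c) + (b - c) + (a - c)) else 0

section

variable {v : ℂ} {a b c : ℕ}

theorem nearDensity_of_le {k d : ℕ} (h : d ≤ k + 1) : nearDensity v b k d = v ^ (k + 1) := by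
  rw [nearDensity, max_eq_right h, show min (d - 1) b - k = 0 by omega]; simp

theorem nearDensity_of_lt {k d t : ℕ} (h : k < d) (ht : min (d - 1) b = k + t) :
    nearDensity v b k d = v ^ d * (1 + t * (1 - v)) := by
  rw [nearDensity, max_eq_left (by omega), ht, Nat.add_sub_cancel_left]

theorem density_c1 (h : a + b ≤ c) :
    latticeDensity v c a b - cornerDensity v c a b = (1 + v) * (1 + v + v ^ 2) := by
  rw [latticeDensity, cornerDensity, if_pos h, if_neg (show ¬ (c < a ∧ c < b) by omega), sub_zero]

theorem density_c2 (h : c < a + b) (ha : a ≤ c) (hb : b ≤ c) :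
    latticeDensity v c a b - cornerDensity v c a b =
      v ^ (a + b - c) * (1 + 8 * v + v ^ 2) := by
  rw [latticeDensity, cornerDensity, if_neg (show ¬ a + b ≤ c by omega),
    if_neg (show ¬ (c < a ∧ c < b) by omega), sub_zero,
    show a - c = 0 by omega, show b - c = 0 by omega, nearDensity_of_le (by omega), genericDensity,
    if_pos (by omega), if_pos hb, if_pos ha]
  simp only [zero_le, max_eq_left]
  ring

theorem density_c3 {d : ℕ} (h : a = c + (d + 1)) (hb : b ≤ c) (hd : d + 1 ≤ b) :
    latticeDensity v c a b - cornerDensity v c a b =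
      v ^ (b + (d + 1)) * v ^ (d + 1) * ((10 - 2 * v) + 12 * (1 - v) * d) := by
  rw [latticeDensity, cornerDensity, if_neg (show ¬ a + b ≤ c by omega),
    if_neg (show ¬ (c < a ∧ c < b) by omega), sub_zero,
    show a - c = d + 1 by omega, show b - c = 0 by omega, genericDensity,
    if_pos (by omega), if_pos hb, if_neg (by omega), max_eq_left (by omega : 0 ≤ 1),
    max_eq_right (by omega : 1 ≤ d + 1), show a + b - c = b + (d + 1) by omega]
  -- For d = 0 the maximum in `nearDensity` is attained by its other argument; the result still fits
  -- the linear formula.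
  rcases Nat.eq_zero_or_pos d with rfl | hd0
  · rw [nearDensity_of_le (by omega)]
    push_cast; ring
  · obtain ⟨m, rfl⟩ := Nat.exists_eq_add_of_le' hd0
    rw [nearDensity_of_lt (t := m) (by omega) (by omega)]
    push_cast; ring

theorem density_c4 {i k : ℕ} (hi : b = i + 1) (h : a = b + c + (k + 1)) (hb : b ≤ c) :
    latticeDensity v c a b - cornerDensity v c a b =
      v ^ (2 * i + k + 3) * v ^ (i + k + 2) * ((18 - 6 * v) + 12 * (1 - v) * i) := by
  rw [latticeDensity, cornerDensity, if_neg (show ¬ a + b ≤ c by omega),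
    if_neg (show ¬ (c < a ∧ c < b) by omega), sub_zero,
    show a - c = i + k + 2 by omega, show b - c = 0 by omega, genericDensity,
    if_neg (by omega), if_pos hb, if_neg (by omega), max_eq_left (by omega : 0 ≤ 1),
    max_eq_right (by omega : 1 ≤ i + k + 2), show a + b - c = 2 * i + k + 3 by omega,
    nearDensity_of_lt (t := i) (by omega) (by omega)]
  ring

theorem density_c5 {k : ℕ} (ha : a ≤ c) (hb : b = c + (k + 1)) :
    latticeDensity v c a b - cornerDensity v c a b =
      v ^ (a + (k + 1)) * v ^ (k + 1) * (7 * (1 + v)) := by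
  rw [latticeDensity, cornerDensity, show a - c = 0 by omega, show b - c = k + 1 by omega]
  by_cases h : a + b ≤ c
  · omega
  rw [if_neg h, if_neg (show ¬ (c < a ∧ c < b) by omega), sub_zero, genericDensity,
    if_pos (by omega), if_neg (by omega), max_eq_right (by omega : 1 ≤ k + 1),
    show a + b - c = a + (k + 1) by omega, nearDensity_of_le (by omega)]
  simp only [zero_le, max_eq_left]
  ring

theorem density_c6 {j k : ℕ} (ha : a = c + (j + 1)) (hb : b = a + k) :
    latticeDensity v c a b - cornerDensity v c a b =
      v ^ (c + 2 * j + k + 2) * v ^ (j + k + 1) * (4 * (1 + v)) := by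
  rw [latticeDensity, cornerDensity, show a - c = j + 1 by omega,
    show b - c = j + k + 1 by omega, if_neg (show ¬ a + b ≤ c by omega),
    if_pos (show c < a ∧ c < b by omega), genericDensity,
    if_pos (by omega), if_neg (by omega), max_eq_right (by omega : 1 ≤ j + k + 1),
    max_eq_right (by omega : 1 ≤ j + 1),
    show a + b - c = c + 2 * j + k + 2 by omega, nearDensity_of_le (by omega),
    max_eq_left (by omega)]
  ring

theorem density_c7 {j k : ℕ} (hb : b = c + (j + 1)) (ha : a = b + (k + 1)) (h : k + 1 ≤ c) :
    latticeDensity v c a b - cornerDensity v c a b =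
      v ^ (a + j + 1) * v ^ (j + k + 2) * ((16 - 8 * v) + 12 * (1 - v) * k) := by
  rw [latticeDensity, cornerDensity, show a - c = j + k + 2 by omega,
    show b - c = j + 1 by omega, if_neg (show ¬ a + b ≤ c by omega),
    if_pos (show c < a ∧ c < b by omega), genericDensity,
    if_pos (by omega), if_neg (by omega), max_eq_right (by omega : 1 ≤ j + 1),
    max_eq_right (by omega : 1 ≤ j + k + 2),
    show a + b - c = a + j + 1 by omega, nearDensity_of_lt (t := k) (by omega) (by omega),
    max_eq_right (by omega)]
  ring

theorem density_c8 {j k : ℕ} (hb : b = c + (j + 1)) (ha : a = b + c + (k + 1)) :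
    latticeDensity v c a b - cornerDensity v c a b =
      v ^ (2 * c + 2 * j + k + 3) * v ^ (c + j + k + 2) * (12 + 12 * (1 - v) * c) := by
  rw [latticeDensity, cornerDensity, show a - c = c + j + k + 2 by omega,
    show b - c = j + 1 by omega, if_neg (show ¬ a + b ≤ c by omega),
    if_pos (show c < a ∧ c < b by omega), genericDensity,
    if_neg (by omega), if_neg (by omega), max_eq_right (by omega : 1 ≤ j + 1),
    max_eq_right (by omega : 1 ≤ c + j + k + 2),
    show a + b - c = 2 * c + 2 * j + k + 3 by omega,
    nearDensity_of_lt (t := c) (by omega) (by omega)]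
  ring

end

/-- The generating function of `latticeDensity` as a sum over cones. -/
theorem hasSum_latticeDensity_cones (X Y Z v : ℂ) (hX : ‖X‖ < 1) (hXY : ‖X * Y‖ < 1)
    (hXZ : ‖X * Z‖ < 1) (hY : ‖v ^ 2 * Y‖ < 1) (hZ : ‖v ^ 2 * Z‖ < 1)
    (hYZ : ‖v ^ 3 * (Y * Z)‖ < 1) (hXYZ : ‖v * (X * Y * Z)‖ < 1)
    (hW : ‖v ^ 3 * (X * Y ^ 2 * Z)‖ < 1) :
    HasSum (fun x : ℕ × ℕ × ℕ => X ^ x.1 * Y ^ (x.2.1 + 1) * Z ^ (x.2.2 + 1) *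
      latticeDensity v x.1 (x.2.1 + 1) (x.2.2 + 1))
      ((X ^ 2 * Y * Z * ((1 + v) * (1 + v + v ^ 2)) * (1 - X * Y)⁻¹ + 0 * (X * Y / (1 - X * Y) ^ 2)) *
          ((1 - X * Z)⁻¹ * (1 - X)⁻¹)
        + (v * (X * Y * Z) * (1 + 8 * v + v ^ 2) * (1 - X * Y)⁻¹ + 0 * (X * Y / (1 - X * Y) ^ 2)) *
          ((1 - X * Z)⁻¹ * (1 - v * (X * Y * Z))⁻¹)
        + (v ^ 3 * (X * Y ^ 2 * Z) * (10 - 2 * v) * (1 - v ^ 3 * (X * Y ^ 2 * Z))⁻¹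
            + v ^ 3 * (X * Y ^ 2 * Z) * (12 * (1 - v)) *
              (v ^ 3 * (X * Y ^ 2 * Z) / (1 - v ^ 3 * (X * Y ^ 2 * Z)) ^ 2)) *
          ((1 - v * (X * Y * Z))⁻¹ * (1 - X * Y)⁻¹)
        + (v ^ 5 * (X * Y ^ 3 * Z) * (18 - 6 * v) * (1 - v ^ 3 * (X * Y ^ 2 * Z))⁻¹
            + v ^ 5 * (X * Y ^ 3 * Z) * (12 * (1 - v)) *
              (v ^ 3 * (X * Y ^ 2 * Z) / (1 - v ^ 3 * (X * Y ^ 2 * Z)) ^ 2)) *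
          ((1 - X * Y)⁻¹ * (1 - v ^ 2 * Y)⁻¹)
        + (v ^ 3 * (X * Y * Z ^ 2) * (7 * (1 + v)) * (1 - v * (X * Y * Z))⁻¹
            + 0 * (v * (X * Y * Z) / (1 - v * (X * Y * Z)) ^ 2)) *
          ((1 - X * Z)⁻¹ * (1 - v ^ 2 * Z)⁻¹)
        + (v ^ 3 * (Y * Z) * (4 * (1 + v)) * (1 - v * (X * Y * Z))⁻¹
            + 0 * (v * (X * Y * Z) / (1 - v * (X * Y * Z)) ^ 2)) *
          ((1 - v ^ 3 * (Y * Z))⁻¹ * (1 - v ^ 2 * Z)⁻¹)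
        + (v ^ 6 * (X * Y ^ 3 * Z ^ 2) * (16 - 8 * v) * (1 - v ^ 3 * (X * Y ^ 2 * Z))⁻¹
            + v ^ 6 * (X * Y ^ 3 * Z ^ 2) * (12 * (1 - v)) *
              (v ^ 3 * (X * Y ^ 2 * Z) / (1 - v ^ 3 * (X * Y ^ 2 * Z)) ^ 2)) *
          ((1 - v * (X * Y * Z))⁻¹ * (1 - v ^ 3 * (Y * Z))⁻¹)
        + (v ^ 5 * (Y ^ 2 * Z) * 12 * (1 - v ^ 3 * (X * Y ^ 2 * Z))⁻¹
            + v ^ 5 * (Y ^ 2 * Z) * (12 * (1 - v)) *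
              (v ^ 3 * (X * Y ^ 2 * Z) / (1 - v ^ 3 * (X * Y ^ 2 * Z)) ^ 2)) *
          ((1 - v ^ 3 * (Y * Z))⁻¹ * (1 - v ^ 2 * Y)⁻¹)
        + (6 * v ^ 4 * (Y * Z) * (1 - v * (X * Y * Z))⁻¹
            + 0 * (v * (X * Y * Z) / (1 - v * (X * Y * Z)) ^ 2)) *
          ((1 - v ^ 2 * Y)⁻¹ * (1 - v ^ 2 * Z)⁻¹)) := by
  -- The corner term is a single monomial on all of c < a, c < b, so it is summed there as one cone
  -- rather than over the three pieces needed for the rest.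
  obtain ⟨f, hf⟩ : ∃ f : ℕ × ℕ × ℕ → ℂ, ∀ x, f x = X ^ x.1 * Y ^ (x.2.1 + 1) * Z ^ (x.2.2 + 1) *
      (latticeDensity v x.1 (x.2.1 + 1) (x.2.2 + 1) - cornerDensity v x.1 (x.2.1 + 1) (x.2.2 + 1)) :=
    ⟨_, fun _ => rfl⟩
  -- Index triples are (c, a - 1, b - 1). Each cone comes with a map from ℕ³ whose three directions
  -- give the ratios of the series.
  have c1 := hasSum_of_cone (f := f) (fun x => x.2.1 + 1 + (x.2.2 + 1) ≤ x.1)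
    (fun y => (y.1 + y.2.1 + 2 + y.2.2, y.1, y.2.1))
    (fun x => (x.2.1, x.2.2, x.1 - x.2.1 - x.2.2 - 2))
    (by rintro ⟨i, j, k⟩; dsimp only; omega)
    (by rintro ⟨i, j, k⟩; refine Prod.ext ?_ (Prod.ext ?_ ?_) <;> dsimp only <;> omega)
    (by rintro ⟨c, i, j⟩ h; refine Prod.ext ?_ (Prod.ext ?_ ?_) <;> dsimp only at h ⊢ <;> omega)
    ((hasSum_cone_geometric (X ^ 2 * Y * Z * ((1 + v) * (1 + v + v ^ 2))) 0
      hXY hXZ hX).congr_fun (by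
        rintro ⟨i, j, k⟩
        rw [hf, density_c1 (by dsimp only; omega)]
        dsimp only
        ring))
  have c2 := hasSum_of_cone (f := f)
    (fun x => x.1 < x.2.1 + 1 + (x.2.2 + 1) ∧ x.2.1 + 1 ≤ x.1 ∧ x.2.2 + 1 ≤ x.1)
    (fun y => (y.2.2 + 1 + y.1 + y.2.1, y.2.2 + y.1, y.2.2 + y.2.1))
    (fun x => (x.1 - x.2.2 - 1, x.1 - x.2.1 - 1, x.2.1 + x.2.2 + 1 - x.1))
    (by rintro ⟨i, j, k⟩; dsimp only; omega)
    (by rintro ⟨i, j, k⟩; refine Prod.ext ?_ (Prod.ext ?_ ?_) <;> dsimp only <;> omega)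
    (by rintro ⟨c, i, j⟩ h; refine Prod.ext ?_ (Prod.ext ?_ ?_) <;> dsimp only at h ⊢ <;> omega)
    ((hasSum_cone_geometric (v * (X * Y * Z) * (1 + 8 * v + v ^ 2)) 0
      hXY hXZ hXYZ).congr_fun (by
        rintro ⟨i, j, k⟩
        rw [hf, density_c2 (by dsimp only; omega) (by dsimp only; omega) (by dsimp only; omega)]
        dsimp only
        rw [show k + i + 1 + (k + j + 1) - (k + 1 + i + j) = k + 1 by omega]
        ring))
  have c3 := hasSum_of_cone (f := f)
    (fun x => x.2.2 + 1 ≤ x.1 ∧ x.1 < x.2.1 + 1 ∧ x.2.1 + 1 ≤ x.2.2 + 1 + x.1)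
    (fun y => (y.1 + 1 + y.2.1 + y.2.2, 2 * y.1 + 1 + y.2.1 + y.2.2, y.1 + y.2.1))
    (fun x => (x.2.1 - x.1, x.2.2 + x.1 - x.2.1, x.1 - x.2.2 - 1))
    (by rintro ⟨i, j, k⟩; dsimp only; omega)
    (by rintro ⟨i, j, k⟩; refine Prod.ext ?_ (Prod.ext ?_ ?_) <;> dsimp only <;> omega)
    (by rintro ⟨c, i, j⟩ h; refine Prod.ext ?_ (Prod.ext ?_ ?_) <;> dsimp only at h ⊢ <;> omega)
    ((hasSum_cone_geometric (v ^ 3 * (X * Y ^ 2 * Z) * (10 - 2 * v))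
      (v ^ 3 * (X * Y ^ 2 * Z) * (12 * (1 - v))) hW hXYZ hXY).congr_fun (by
        rintro ⟨k, i, j⟩
        rw [hf, density_c3 (d := k) (by dsimp only; omega) (by dsimp only; omega)
          (by dsimp only; omega)]
        dsimp only
        ring))
  have c4 := hasSum_of_cone (f := f)
    (fun x => x.2.2 + 1 ≤ x.1 ∧ x.2.2 + 1 + x.1 < x.2.1 + 1)
    (fun y => (y.1 + 1 + y.2.1, 2 * y.1 + 2 + y.2.1 + y.2.2, y.1))
    (fun x => (x.2.2, x.1 - x.2.2 - 1, x.2.1 - x.2.2 - x.1 - 1))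
    (by rintro ⟨i, j, k⟩; dsimp only; omega)
    (by rintro ⟨i, j, k⟩; refine Prod.ext ?_ (Prod.ext ?_ ?_) <;> dsimp only <;> omega)
    (by rintro ⟨c, i, j⟩ h; refine Prod.ext ?_ (Prod.ext ?_ ?_) <;> dsimp only at h ⊢ <;> omega)
    ((hasSum_cone_geometric (v ^ 5 * (X * Y ^ 3 * Z) * (18 - 6 * v))
      (v ^ 5 * (X * Y ^ 3 * Z) * (12 * (1 - v))) hW hXY hY).congr_fun (by
        rintro ⟨i, j, k⟩
        rw [hf, density_c4 (i := i) (k := k) rfl (by dsimp only; omega) (by dsimp only; omega)]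
        dsimp only
        ring))
  have c5 := hasSum_of_cone (f := f)
    (fun x => x.2.1 + 1 ≤ x.1 ∧ x.1 < x.2.2 + 1)
    (fun y => (y.1 + 1 + y.2.1, y.1, y.1 + 1 + y.2.1 + y.2.2))
    (fun x => (x.2.1, x.1 - x.2.1 - 1, x.2.2 - x.1))
    (by rintro ⟨i, j, k⟩; dsimp only; omega)
    (by rintro ⟨i, j, k⟩; refine Prod.ext ?_ (Prod.ext ?_ ?_) <;> dsimp only <;> omega)
    (by rintro ⟨c, i, j⟩ h; refine Prod.ext ?_ (Prod.ext ?_ ?_) <;> dsimp only at h ⊢ <;> omega)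
    ((hasSum_cone_geometric (v ^ 3 * (X * Y * Z ^ 2) * (7 * (1 + v))) 0
      hXYZ hXZ hZ).congr_fun (by
        rintro ⟨i, j, k⟩
        rw [hf, density_c5 (k := k) (by dsimp only; omega) (by dsimp only; omega)]
        dsimp only
        ring))
  have c6 := hasSum_of_cone (f := f)
    (fun x => x.1 ≤ x.2.1 ∧ x.2.1 ≤ x.2.2)
    (fun y => (y.1, y.1 + y.2.1, y.1 + y.2.1 + y.2.2))
    (fun x => (x.1, x.2.1 - x.1, x.2.2 - x.2.1))
    (by rintro ⟨i, j, k⟩; dsimp only; omega)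
    (by rintro ⟨i, j, k⟩; refine Prod.ext ?_ (Prod.ext ?_ ?_) <;> dsimp only <;> omega)
    (by rintro ⟨c, i, j⟩ h; refine Prod.ext ?_ (Prod.ext ?_ ?_) <;> dsimp only at h ⊢ <;> omega)
    ((hasSum_cone_geometric (v ^ 3 * (Y * Z) * (4 * (1 + v))) 0
      hXYZ hYZ hZ).congr_fun (by
        rintro ⟨i, j, k⟩
        rw [hf, density_c6 (j := j) (k := k) (by dsimp only; omega) (by dsimp only; omega)]
        dsimp only
        ring))
  have c7 := hasSum_of_cone (f := f)
    (fun x => x.1 < x.2.2 + 1 ∧ x.2.2 < x.2.1 ∧ x.2.1 + 1 ≤ x.2.2 + 1 + x.1)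
    (fun y => (y.1 + 1 + y.2.1, 2 * y.1 + y.2.1 + y.2.2 + 2, y.1 + y.2.1 + y.2.2 + 1))
    (fun x => (x.2.1 - x.2.2 - 1, x.1 - (x.2.1 - x.2.2), x.2.2 - x.1))
    (by rintro ⟨i, j, k⟩; dsimp only; omega)
    (by rintro ⟨i, j, k⟩; refine Prod.ext ?_ (Prod.ext ?_ ?_) <;> dsimp only <;> omega)
    (by rintro ⟨c, i, j⟩ h; refine Prod.ext ?_ (Prod.ext ?_ ?_) <;> dsimp only at h ⊢ <;> omega)
    ((hasSum_cone_geometric (v ^ 6 * (X * Y ^ 3 * Z ^ 2) * (16 - 8 * v))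
      (v ^ 6 * (X * Y ^ 3 * Z ^ 2) * (12 * (1 - v))) hW hXYZ hYZ).congr_fun (by
        rintro ⟨k, i, j⟩
        rw [hf, density_c7 (j := j) (k := k) (by dsimp only; omega) (by dsimp only; omega)
          (by dsimp only; omega)]
        dsimp only
        ring))
  have c8 := hasSum_of_cone (f := f)
    (fun x => x.1 < x.2.2 + 1 ∧ x.2.2 + 1 + x.1 < x.2.1 + 1)
    (fun y => (y.1, 2 * y.1 + y.2.1 + y.2.2 + 1, y.1 + y.2.1))
    (fun x => (x.1, x.2.2 - x.1, x.2.1 - x.2.2 - x.1 - 1))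
    (by rintro ⟨i, j, k⟩; dsimp only; omega)
    (by rintro ⟨i, j, k⟩; refine Prod.ext ?_ (Prod.ext ?_ ?_) <;> dsimp only <;> omega)
    (by rintro ⟨c, i, j⟩ h; refine Prod.ext ?_ (Prod.ext ?_ ?_) <;> dsimp only at h ⊢ <;> omega)
    ((hasSum_cone_geometric (v ^ 5 * (Y ^ 2 * Z) * 12)
      (v ^ 5 * (Y ^ 2 * Z) * (12 * (1 - v))) hW hYZ hY).congr_fun (by
        rintro ⟨i, j, k⟩
        rw [hf, density_c8 (j := j) (k := k) (by dsimp only; omega) (by dsimp only; omega)]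
        dsimp only
        ring))
  have c9 := hasSum_of_cone (f := fun x => X ^ x.1 * Y ^ (x.2.1 + 1) * Z ^ (x.2.2 + 1) *
      cornerDensity v x.1 (x.2.1 + 1) (x.2.2 + 1))
    (fun x => x.1 < x.2.1 + 1 ∧ x.1 < x.2.2 + 1)
    (fun y => (y.1, y.1 + y.2.1, y.1 + y.2.2))
    (fun x => (x.1, x.2.1 - x.1, x.2.2 - x.1))
    (by rintro ⟨i, j, k⟩; dsimp only; omega)
    (by rintro ⟨i, j, k⟩; refine Prod.ext ?_ (Prod.ext ?_ ?_) <;> dsimp only <;> omega)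
    (by rintro ⟨c, i, j⟩ h; refine Prod.ext ?_ (Prod.ext ?_ ?_) <;> dsimp only at h ⊢ <;> omega)
    ((hasSum_cone_geometric (6 * v ^ 4 * (Y * Z)) 0 hXYZ hY hZ).congr_fun (by
        rintro ⟨i, j, k⟩
        dsimp only
        rw [cornerDensity, if_pos (by omega), show i + j + 1 + (i + k + 1) - i = i + j + k + 2 by
          omega, show i + k + 1 - i = k + 1 by omega, show i + j + 1 - i = j + 1 by omega]
        ring))
  refine ((((((((c1.add c2).add c3).add c4).add c5).add c6).add c7).add c8).add c9).congr_fun ?_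
  rintro ⟨c, i, j⟩
  dsimp only
  have h9 : (if c < i + 1 ∧ c < j + 1 then X ^ c * Y ^ (i + 1) * Z ^ (j + 1) *
      cornerDensity v c (i + 1) (j + 1) else 0) = X ^ c * Y ^ (i + 1) * Z ^ (j + 1) *
      cornerDensity v c (i + 1) (j + 1) := by
    split_ifs with h
    · rfl
    · rw [cornerDensity, if_neg h, mul_zero]
  rw [h9]
  have h8 : X ^ c * Y ^ (i + 1) * Z ^ (j + 1) * latticeDensity v c (i + 1) (j + 1) =
      f (c, i, j) + X ^ c * Y ^ (i + 1) * Z ^ (j + 1) * cornerDensity v c (i + 1) (j + 1) := by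
    rw [hf]; ring
  rw [h8]
  congr 1
  -- The eight cones are disjoint and exhaustive, so exactly one summand survives at each point.
  by_cases h1 : i + 1 + (j + 1) ≤ c
  · rw [if_pos h1, if_neg (by omega), if_neg (by omega), if_neg (by omega), if_neg (by omega),
      if_neg (by omega), if_neg (by omega), if_neg (by omega)]; ring
  by_cases h2 : c < i + 1 + (j + 1) ∧ i + 1 ≤ c ∧ j + 1 ≤ c
  · rw [if_neg h1, if_pos h2, if_neg (by omega), if_neg (by omega), if_neg (by omega),
      if_neg (by omega), if_neg (by omega), if_neg (by omega)]; ring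
  by_cases h3 : j + 1 ≤ c ∧ c < i + 1 ∧ i + 1 ≤ j + 1 + c
  · rw [if_neg h1, if_neg h2, if_pos h3, if_neg (by omega), if_neg (by omega),
      if_neg (by omega), if_neg (by omega), if_neg (by omega)]; ring
  by_cases h4 : j + 1 ≤ c ∧ j + 1 + c < i + 1
  · rw [if_neg h1, if_neg h2, if_neg h3, if_pos h4, if_neg (by omega),
      if_neg (by omega), if_neg (by omega), if_neg (by omega)]; ring
  by_cases h5 : i + 1 ≤ c ∧ c < j + 1
  · rw [if_neg h1, if_neg h2, if_neg h3, if_neg h4, if_pos h5,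
      if_neg (by omega), if_neg (by omega), if_neg (by omega)]; ring
  by_cases h6 : c ≤ i ∧ i ≤ j
  · rw [if_neg h1, if_neg h2, if_neg h3, if_neg h4, if_neg h5,
      if_pos h6, if_neg (by omega), if_neg (by omega)]; ring
  by_cases h7 : c < j + 1 ∧ j < i ∧ i + 1 ≤ j + 1 + c
  · rw [if_neg h1, if_neg h2, if_neg h3, if_neg h4, if_neg h5,
      if_neg h6, if_pos h7, if_neg (by omega)]; ring
  · rw [if_neg h1, if_neg h2, if_neg h3, if_neg h4, if_neg h5,
      if_neg h6, if_neg h7, if_pos (by omega)]; ring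

/-! ### The series Ξ and the closed rational form -/

/-- The factor (q^(a+b))² of the count accounts for the summand 2 in the exponents of Y and Z. -/
theorem xiTerm_eq {O : Type*} [CommRing O] [IsDomain O] [IsDiscreteValuationRing O]
    {π : O} (hπ : Irreducible π) {q : ℕ} {T : ℕ → Finset O} (hT : IsResidueSystem π q T)
    (hq : 1 < q) (hqO : residueCard O = q) (s₀ : ℂ) (s : ℕ → ℂ)
    (k : ℕ × (({1, 2} : Finset ℕ) → ℕ+)) :
    xiTerm π 3 {1, 2} s₀ s k =
      ((q : ℂ) ^ (-(3 * s₀))) ^ k.1 * ((q : ℂ) ^ (-(s 1) + 2)) ^ (k.2 ⟨1, by simp⟩ : ℕ) *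
        ((q : ℂ) ^ (-(2 * s 2) + 2)) ^ (k.2 ⟨2, by simp⟩ : ℕ) *
        latticeDensity (q : ℂ)⁻¹ k.1 (k.2 ⟨1, by simp⟩) (k.2 ⟨2, by simp⟩) := by
  have hq0 : (q : ℂ) ≠ 0 := by exact_mod_cast (by omega : q ≠ 0)
  have hu : (Finset.univ : Finset ({1, 2} : Finset ℕ)) = {⟨1, by simp⟩, ⟨2, by simp⟩} := by
    decide
  rw [xiTerm, cast_subalgebraCount hπ hT hq k.2 rfl rfl, hqO, hu, Finset.sum_pair (by simp),
    ← mul_assoc]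
  congr 1
  rw [← pow_mul, ← Complex.cpow_natCast, ← Complex.cpow_add _ _ hq0, ← Complex.cpow_nat_mul,
    ← Complex.cpow_nat_mul, ← Complex.cpow_nat_mul, ← Complex.cpow_add _ _ hq0,
    ← Complex.cpow_add _ _ hq0]
  congr 1
  push_cast
  ring

/-- The exponents `(r₁, r₂)`, shifted by one, as a function on `{1, 2}`. -/
def exponentEquiv : ℕ × ℕ × ℕ ≃ ℕ × (({1, 2} : Finset ℕ) → ℕ+) where
  toFun x := (x.1, fun ι => if (ι : ℕ) = 1 then x.2.1.succPNat else x.2.2.succPNat)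
  invFun k := (k.1, (k.2 ⟨1, by simp⟩).natPred, (k.2 ⟨2, by simp⟩).natPred)
  left_inv := by rintro ⟨c, i, j⟩; simp
  right_inv := by
    rintro ⟨c, r⟩
    refine Prod.ext rfl (funext ?_)
    rintro ⟨ι, hι⟩
    simp only [Finset.mem_insert, Finset.mem_singleton] at hι
    rcases hι with rfl | rfl <;> simp

/-- The numerator `P`, written as a polynomial in `v = q⁻¹`. -/
theorem pow_mul_numeratorP (X Y Z : ℂ) {v : ℂ} (hv : v ≠ 0) :
    v ^ 11 * numeratorP X Y Z v⁻¹ = (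
      ( (4 * v ^ 3 + 10 * v ^ 4) + (8 * v ^ 5 - 4 * v ^ 6) * Y - 18 * v ^ 7 * Y * Z)
      + ( (v ^ 1 + 8 * v ^ 2 - 3 * v ^ 3 - 10 * v ^ 4) + (2 * v ^ 3 - 11 * v ^ 4 - v ^ 5) *
      Z + (5 * v ^ 3 - 20 * v ^ 4 - 9 * v ^ 5 + 4 * v ^ 6) * Y + (-v ^ 4 - 32 * v ^ 5 + 6 *
      v ^ 6 + 19 * v ^ 7) * Y * Z + (-6 * v ^ 6 + 19 * v ^ 7 + v ^ 8) * Y * Z ^ 2 + (-5 * v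
      ^ 6 + 12 * v ^ 7 + 5 * v ^ 8) * Y ^ 2 * Z + (12 * v ^ 8 + 5 * v ^ 9 - v ^ 10) * Y ^ 2
      * Z ^ 2) * X
      + ( (v ^ 0 + v ^ 1 - 6 * v ^ 2) + (-v ^ 2 - 7 * v ^ 3 + 18 * v ^ 4) * Y + (-v ^ 2 - 4
      * v ^ 3 + 9 * v ^ 4) * Z + (-14 * v ^ 3 + 5 * v ^ 4 + 32 * v ^ 5 - 5 * v ^ 6) * Y * Z
      + (11 * v ^ 5 + 6 * v ^ 6 - 17 * v ^ 7) * Y * Z ^ 2 + (8 * v ^ 5 + 14 * v ^ 6 - 10 * v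
      ^ 7 - 4 * v ^ 8) * Y ^ 2 * Z + (13 * v ^ 6 + 2 * v ^ 7 - 18 * v ^ 8 - 7 * v ^ 9) * Y ^
      2 * Z ^ 2 + (-7 * v ^ 8 - 7 * v ^ 9) * Y ^ 3 * Z ^ 2 + (-6 * v ^ 8 - 6 * v ^ 9) * Y ^
      2 * Z ^ 3) * X ^ 2
      + ( (-v ^ 1 - 2 * v ^ 2 + 11 * v ^ 3 - 6 * v ^ 4) * Y * Z + (v ^ 3 + 2 * v ^ 4 - 8 * v
      ^ 5 + 3 * v ^ 6) * Y * Z ^ 2 + (v ^ 3 + 2 * v ^ 4 - 5 * v ^ 5 - 6 * v ^ 6) * Y ^ 2 * Z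
      + (v ^ 4 + v ^ 5 - 13 * v ^ 6 - 4 * v ^ 7 + 3 * v ^ 8) * Y ^ 2 * Z ^ 2 + (-v ^ 6 - 2 *
      v ^ 7 + 4 * v ^ 8 + 5 * v ^ 9) * Y ^ 2 * Z ^ 3 + (-v ^ 6 - 2 * v ^ 7 + 5 * v ^ 8 + 6 *
      v ^ 9) * Y ^ 3 * Z ^ 2 + (v ^ 8 + 2 * v ^ 9 + 2 * v ^ 10 + 1 * v ^ 11) * Y ^ 3 * Z ^
      3) * X ^ 3) := by
  simp only [numeratorP, coeffA0, coeffA1, coeffA2, coeffA3]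
  field_simp

set_option maxHeartbeats 4000000 in
/-- The sum over the cones as a single rational function. -/
theorem cones_eq (X Y Z v : ℂ) (hX : 1 - X ≠ 0) (hXY : 1 - X * Y ≠ 0)
    (hXZ : 1 - X * Z ≠ 0) (hY : 1 - v ^ 2 * Y ≠ 0) (hZ : 1 - v ^ 2 * Z ≠ 0)
    (hYZ : 1 - v ^ 3 * (Y * Z) ≠ 0) (hXYZ : 1 - v * (X * Y * Z) ≠ 0)
    (hW : 1 - v ^ 3 * (X * Y ^ 2 * Z) ≠ 0) (q : ℂ) (hq : q * v = 1) :
      ((X ^ 2 * Y * Z * ((1 + v) * (1 + v + v ^ 2)) * (1 - X * Y)⁻¹ + 0 * (X * Y / (1 - X * Y) ^ 2)) *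
          ((1 - X * Z)⁻¹ * (1 - X)⁻¹)
        + (v * (X * Y * Z) * (1 + 8 * v + v ^ 2) * (1 - X * Y)⁻¹ + 0 * (X * Y / (1 - X * Y) ^ 2)) *
          ((1 - X * Z)⁻¹ * (1 - v * (X * Y * Z))⁻¹)
        + (v ^ 3 * (X * Y ^ 2 * Z) * (10 - 2 * v) * (1 - v ^ 3 * (X * Y ^ 2 * Z))⁻¹
            + v ^ 3 * (X * Y ^ 2 * Z) * (12 * (1 - v)) *
              (v ^ 3 * (X * Y ^ 2 * Z) / (1 - v ^ 3 * (X * Y ^ 2 * Z)) ^ 2)) *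
          ((1 - v * (X * Y * Z))⁻¹ * (1 - X * Y)⁻¹)
        + (v ^ 5 * (X * Y ^ 3 * Z) * (18 - 6 * v) * (1 - v ^ 3 * (X * Y ^ 2 * Z))⁻¹
            + v ^ 5 * (X * Y ^ 3 * Z) * (12 * (1 - v)) *
              (v ^ 3 * (X * Y ^ 2 * Z) / (1 - v ^ 3 * (X * Y ^ 2 * Z)) ^ 2)) *
          ((1 - X * Y)⁻¹ * (1 - v ^ 2 * Y)⁻¹)
        + (v ^ 3 * (X * Y * Z ^ 2) * (7 * (1 + v)) * (1 - v * (X * Y * Z))⁻¹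
            + 0 * (v * (X * Y * Z) / (1 - v * (X * Y * Z)) ^ 2)) *
          ((1 - X * Z)⁻¹ * (1 - v ^ 2 * Z)⁻¹)
        + (v ^ 3 * (Y * Z) * (4 * (1 + v)) * (1 - v * (X * Y * Z))⁻¹
            + 0 * (v * (X * Y * Z) / (1 - v * (X * Y * Z)) ^ 2)) *
          ((1 - v ^ 3 * (Y * Z))⁻¹ * (1 - v ^ 2 * Z)⁻¹)
        + (v ^ 6 * (X * Y ^ 3 * Z ^ 2) * (16 - 8 * v) * (1 - v ^ 3 * (X * Y ^ 2 * Z))⁻¹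
            + v ^ 6 * (X * Y ^ 3 * Z ^ 2) * (12 * (1 - v)) *
              (v ^ 3 * (X * Y ^ 2 * Z) / (1 - v ^ 3 * (X * Y ^ 2 * Z)) ^ 2)) *
          ((1 - v * (X * Y * Z))⁻¹ * (1 - v ^ 3 * (Y * Z))⁻¹)
        + (v ^ 5 * (Y ^ 2 * Z) * 12 * (1 - v ^ 3 * (X * Y ^ 2 * Z))⁻¹
            + v ^ 5 * (Y ^ 2 * Z) * (12 * (1 - v)) *
              (v ^ 3 * (X * Y ^ 2 * Z) / (1 - v ^ 3 * (X * Y ^ 2 * Z)) ^ 2)) *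
          ((1 - v ^ 3 * (Y * Z))⁻¹ * (1 - v ^ 2 * Y)⁻¹)
        + (6 * v ^ 4 * (Y * Z) * (1 - v * (X * Y * Z))⁻¹
            + 0 * (v * (X * Y * Z) / (1 - v * (X * Y * Z)) ^ 2)) *
          ((1 - v ^ 2 * Y)⁻¹ * (1 - v ^ 2 * Z)⁻¹)) =
      Y * Z * numeratorP X Y Z q /
        (q ^ 11 * (1 - X) * (1 - X * Y) * (1 - X * Z) * (1 - v ^ 2 * Y) * (1 - v ^ 2 * Z)
          * (1 - v ^ 3 * (Y * Z)) * (1 - v * (X * Y * Z))) := by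
  have hv : v ≠ 0 := right_ne_zero_of_mul_eq_one hq
  obtain rfl : q = v⁻¹ := eq_inv_of_mul_eq_one_left hq
  have hP : Y * Z * numeratorP X Y Z v⁻¹ /
        (v⁻¹ ^ 11 * (1 - X) * (1 - X * Y) * (1 - X * Z) * (1 - v ^ 2 * Y) * (1 - v ^ 2 * Z)
          * (1 - v ^ 3 * (Y * Z)) * (1 - v * (X * Y * Z))) =
      Y * Z * (v ^ 11 * numeratorP X Y Z v⁻¹) /
        ((1 - X) * (1 - X * Y) * (1 - X * Z) * (1 - v ^ 2 * Y) * (1 - v ^ 2 * Z)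
          * (1 - v ^ 3 * (Y * Z)) * (1 - v * (X * Y * Z))) := by
    rw [div_eq_div_iff (by positivity) (by positivity)]
    field_simp
  rw [hP, pow_mul_numeratorP X Y Z hv]
  clear hP
  simp only [zero_mul, add_zero]
  -- The denominators stay atomic while fractions are cleared and are expanded only for the final
  -- polynomial identity, in which the factor d8 coming from 1 - v³XY²Z is seen to cancel.
  generalize h1 : 1 - X = d1 at *
  generalize h2 : 1 - X * Y = d2 at *
  generalize h3 : 1 - X * Z = d3 at *
  generalize h4 : 1 - v ^ 2 * Y = d4 at *
  generalize h5 : 1 - v ^ 2 * Z = d5 at *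
  generalize h6 : 1 - v ^ 3 * (Y * Z) = d6 at *
  generalize h7 : 1 - v * (X * Y * Z) = d7 at *
  generalize h8 : 1 - v ^ 3 * (X * Y ^ 2 * Z) = d8 at *
  field_simp
  subst h1 h2 h3 h4 h5 h6 h7 h8
  ring

theorem norm_natCast_cpow_lt_one {q : ℕ} (hq : 1 < q) {z : ℂ} (hz : z.re < 0) :
    ‖(q : ℂ) ^ z‖ < 1 := by
  rw [Complex.norm_natCast_cpow_of_pos (by omega)]
  exact Real.rpow_lt_one_of_one_lt_of_neg (by exact_mod_cast hq) hz

theorem one_sub_ne_zero_of_norm_lt_one {z : ℂ} (hz : ‖z‖ < 1) : 1 - z ≠ 0 := by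
  intro h
  rw [sub_eq_zero] at h
  rw [← h, norm_one] at hz
  exact lt_irrefl _ hz

theorem mainTheorem2 {O : Type*} [CommRing O] [IsDomain O] [IsDiscreteValuationRing O]
    [TopologicalSpace O] [CompactSpace O] (hadic : IsAdic (IsLocalRing.maximalIdeal O))
    (π : O) (hπ : Irreducible π)
    (q : ℂ) (hq : q = (residueCard O : ℂ))
    (s₀ : ℂ) (s : ℕ → ℂ)
    (h0 : 0 < s₀.re) (h1 : 0 < (s 1).re) (h2 : 0 < (s 2).re)
    (h01 : 2 < 3 * s₀.re + (s 1).re)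
    (h02 : 2 < 3 * s₀.re + 2 * (s 2).re)
    (h12 : 1 < (s 1).re + 2 * (s 2).re)
    (h012 : 3 < 3 * s₀.re + (s 1).re + 2 * (s 2).re)
    (X Y Z : ℂ) (hX : X = q ^ (-(3 * s₀))) (hY : Y = q ^ (-(s 1) + 2))
    (hZ : Z = q ^ (-(2 * s 2) + 2)) :
    Summable (xiTerm π 3 {1, 2} s₀ s) ∧
    xi π 3 {1, 2} s₀ s =
      Y * Z * numeratorP X Y Z q /
        (q ^ 11 * (1 - X) * (1 - X * Y) * (1 - X * Z) * (1 - q⁻¹ ^ 2 * Y) * (1 - q⁻¹ ^ 2 * Z)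
          * (1 - q⁻¹ ^ 3 * (Y * Z)) * (1 - q⁻¹ * (X * Y * Z))) := by
  have := finite_residueField_of_isAdic hadic
  obtain ⟨T, hT⟩ := exists_isResidueSystem hπ
  have hq1 : 1 < residueCard O := one_lt_residueCard O
  generalize hqO : residueCard O = m at hT hq1 hq
  have hq0 : q ≠ 0 := by rw [hq]; exact_mod_cast (by omega : m ≠ 0)
  have hlt : ∀ (z x : ℂ), z.re < 0 → x = q ^ z → ‖x‖ < 1 := by
    rintro z x hz rfl
    rw [hq]
    exact norm_natCast_cpow_lt_one hq1 hz
  have hinv : ∀ n : ℕ, q⁻¹ ^ n = q ^ (-(n : ℂ)) := fun n => by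
    rw [Complex.cpow_neg, Complex.cpow_natCast, inv_pow]
  have hadd : ∀ x y : ℂ, q ^ (x + y) = q ^ x * q ^ y := fun x y => Complex.cpow_add x y hq0
  have hinv1 : q⁻¹ = q ^ (-((1 : ℕ) : ℂ)) := by rw [← hinv, pow_one]
  have hXn : ‖X‖ < 1 := hlt (-(3 * s₀)) X (by simp; linarith) hX
  have hXYn : ‖X * Y‖ < 1 := hlt (-(3 * s₀) + (-(s 1) + 2)) _ (by simp; linarith)
    (by rw [hadd, ← hX, ← hY])
  have hXZn : ‖X * Z‖ < 1 := hlt (-(3 * s₀) + (-(2 * s 2) + 2)) _ (by simp; linarith)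
    (by rw [hadd, ← hX, ← hZ])
  have hYn : ‖q⁻¹ ^ 2 * Y‖ < 1 := hlt (-((2 : ℕ) : ℂ) + (-(s 1) + 2)) _ (by simp; linarith)
    (by rw [hadd, ← hinv, ← hY])
  have hZn : ‖q⁻¹ ^ 2 * Z‖ < 1 :=
    hlt (-((2 : ℕ) : ℂ) + (-(2 * s 2) + 2)) _ (by simp; linarith)
      (by rw [hadd, ← hinv, ← hZ])
  have hYZn : ‖q⁻¹ ^ 3 * (Y * Z)‖ < 1 :=
    hlt (-((3 : ℕ) : ℂ) + ((-(s 1) + 2) + (-(2 * s 2) + 2))) _ (by simp; linarith)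
      (by rw [hadd, hadd (-(s 1) + 2), ← hinv, ← hY, ← hZ])
  have hXYZn : ‖q⁻¹ * (X * Y * Z)‖ < 1 :=
    hlt (-((1 : ℕ) : ℂ) + ((-(3 * s₀) + (-(s 1) + 2)) + (-(2 * s 2) + 2))) _
      (by simp; linarith)
      (by rw [hadd, hadd (-(3 * s₀) + (-(s 1) + 2)), hadd (-(3 * s₀)), ← hinv1, ← hX, ← hY, ← hZ])
  -- The auxiliary ratio is the product of q⁻¹XYZ and q⁻²Y, so it needs no hypothesis of its own.
  have hWn : ‖q⁻¹ ^ 3 * (X * Y ^ 2 * Z)‖ < 1 := by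
    have h : q⁻¹ ^ 3 * (X * Y ^ 2 * Z) = (q⁻¹ * (X * Y * Z)) * (q⁻¹ ^ 2 * Y) := by ring
    rw [h, norm_mul]
    exact mul_lt_one_of_nonneg_of_lt_one_left (norm_nonneg _) hXYZn hYn.le
  have hsum := hasSum_latticeDensity_cones X Y Z q⁻¹ hXn hXYn hXZn hYn hZn hYZn hXYZn hWn
  rw [cones_eq X Y Z q⁻¹ (one_sub_ne_zero_of_norm_lt_one hXn)
    (one_sub_ne_zero_of_norm_lt_one hXYn) (one_sub_ne_zero_of_norm_lt_one hXZn)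
    (one_sub_ne_zero_of_norm_lt_one hYn) (one_sub_ne_zero_of_norm_lt_one hZn)
    (one_sub_ne_zero_of_norm_lt_one hYZn) (one_sub_ne_zero_of_norm_lt_one hXYZn)
    (one_sub_ne_zero_of_norm_lt_one hWn) q (mul_inv_cancel₀ hq0)] at hsum
  suffices h : ∀ x, xiTerm π 3 {1, 2} s₀ s (exponentEquiv x) = X ^ x.1 * Y ^ (x.2.1 + 1) *
      Z ^ (x.2.2 + 1) * latticeDensity q⁻¹ x.1 (x.2.1 + 1) (x.2.2 + 1) by
    have hxi := exponentEquiv.hasSum_iff.1 ((funext h : xiTerm π 3 {1, 2} s₀ s ∘ exponentEquiv = _) ▸ hsum)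
    exact ⟨hxi.summable, hxi.tsum_eq⟩
  intro x
  rw [xiTerm_eq hπ hT hq1 hqO, hX, hY, hZ, hq]
  simp [exponentEquiv]
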